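/- Let $\mathsf H$ be a separable real Hilbert space and let $(\Omega,\mathcal F,\mathsf P)$ be a probability space; random variables are $\mathcal F$-measurable maps, $\mathsf E$ denotes expectation, and $\mathsf E(\cdot\mid\mathcal X)$ conditional expectation given a sub-$\sigma$-algebra $\mathcal X$. Let $T\colon\mathsf H\to\mathsf H$ be nonexpansive (that is, $\|Tu-Tv\|\le\|u-v\|$ for all $u,v\in\mathsf H$) with $\operatorname{Fix}T=\{z\in\mathsf H: Tz=z\}\neq\varnothing$. Let $x_0\in L^2(\Omega,\mathcal F,\mathsf P;\mathsf H)$ and, for every $n\in\mathbb N$, let $e_n\in L^2(\Omega,\mathcal F,\mathsf P;\mathsf H)$, let $\mu_n$ be a real random variable with values in $]0,1[$ almost surely, and let $$x_{n+1}=x_n+\mu_n\bigl(Tx_n+e_n-x_n\bigr)\quad\text{a.s.}$$ Set $\mathcal X_n=\sigma(x_0,\dots,x_n)$. Suppose that $\sum_{n\in\mathbb N}\mathsf E\bigl(\mu_n(1-\mu_n)\bigr)=+\infty$ and that, for every $n\in\mathbb N$, $\mu_n$ is independent of $\sigma(e_n,x_0,\dots,x_n)$. An operator $S\colon\mathsf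 H\to\mathsf H$ is called demiregular at $z\in\mathsf H$ if every sequence $(u_n)$ in $\mathsf H$ with $u_n\rightharpoonup z$ (weakly) and $Su_n\to Sz$ (strongly) satisfies $u_n\to z$ strongly. **Theorem.** There exists a $\operatorname{Fix}T$-valued random variable $x$ such that the following hold. (i) Suppose that $\mathsf E(\|e_n\|^2\mid\mathcal X_n)\to0$ a.s. and $\sum_{n\in\mathbb N}(\mathsf E\mu_n)\sqrt{\mathsf E(\|e_n\|^2\mid\mathcal X_n)}<+\infty$ a.s. Then: (a) $Tx_n-x_n\to0$ strongly a.s.; (b) $x_n\rightharpoonup x$ weakly a.s.; (c) if $T-\mathrm{Id}$ is demiregular at every point of $\operatorname{Fix}T$, then $x_n\to x$ strongly a.s. (ii) Suppose that $\mathsf E\|e_n\|^2\to0$ and $\sum_{n\in\mathbb N}\sqrt{\mathsf E\mu_n^2\;\mathsf E\|e_n\|^2}<+\infty$. Then: (a) $Tx_n-x_n\to0$ strongly in $L^1(\Omega,\mathcal F,\mathsf P;\mathsf H)$ and strongly a.s.; (b) $x\in L^2(\Omega,\mathcal F,\mathsf P;\mathsf H)$, and $(x_n)$ converges to $x$ weakly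 in $L^2(\Omega,\mathcal F,\mathsf P;\mathsf H)$ and weakly a.s.; (c) if $T-\mathrm{Id}$ is demiregular at every point of $\operatorname{Fix}T$, then $x_n\to x$ strongly in $L^1(\Omega,\mathcal F,\mathsf P;\mathsf H)$ and strongly a.s. -/

import Mathlib

open MeasureTheory ProbabilityTheory Filter Topology

/-- Weak convergence of a sequence in a real normed space: convergence in Mathlib's weak
topology of the space. -/
def WeakTendsto {E : Type*} [NormedAddCommGroup E] [NormedSpace ℝ E]
    (u : ℕ → E) (a : E) : Prop :=
  Tendsto (fun n => toWeakSpace ℝ E (u n)) atTop (𝓝 (toWeakSpace ℝ E a))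

/-- An operator `S` is demiregular at `a` if every sequence that converges weakly to `a` and whose
image under `S` converges strongly to `S a` converges strongly to `a`. -/
def Demiregular {H : Type*} [NormedAddCommGroup H] [NormedSpace ℝ H]
    (S : H → H) (a : H) : Prop :=
  ∀ u : ℕ → H, WeakTendsto u a → Tendsto (fun n => S (u n)) atTop (𝓝 (S a)) →
    Tendsto u atTop (𝓝 a)

/-- The σ-algebra generated by the random variables `x 0, …, x n`. -/
@[reducible] def sigmaUpTo {Ω H : Type*} [MeasurableSpace H] (x : ℕ → Ω → H) (n : ℕ) : MeasurableSpace Ω :=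
  ⨆ k : ℕ, ⨆ _ : k ≤ n, MeasurableSpace.comap (x k) inferInstance

/-- Strong convergence in `L¹(Ω, P; H)`; all terms and the limit are required to lie in `L¹`. -/
def TendstoInL1 {Ω H : Type*} [MeasurableSpace Ω] [NormedAddCommGroup H]
    (P : Measure Ω) (y : ℕ → Ω → H) (z : Ω → H) : Prop :=
  (∀ n, MemLp (y n) 1 P) ∧ MemLp z 1 P ∧
    Tendsto (fun n => eLpNorm (fun ω => y n ω - z ω) 1 P) atTop (𝓝 0)

/-- Weak convergence in the Banach space `L²(Ω, P; H)`; all terms and the limit are required to lie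
in `L²`. -/
def WeakTendstoInL2 {Ω H : Type*} [MeasurableSpace Ω] [NormedAddCommGroup H] [NormedSpace ℝ H]
    (P : Measure Ω) (y : ℕ → Ω → H) (z : Ω → H) : Prop :=
  ∃ (hy : ∀ n, MemLp (y n) 2 P) (hz : MemLp z 2 P),
    WeakTendsto (E := Lp H 2 P) (fun n => (hy n).toLp (y n)) (hz.toLp z)

open scoped RealInnerProductSpace

/-! ### Weak convergence, Opial's lemma, measurable selection of weak limits. -/

section Weak

variable {H : Type*} [NormedAddCommGroup H] [InnerProductSpace ℝ H]

/-! For a fixed point z, one step satisfies three pathwise inequalities: ‖x_n - z‖ grows by at most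
μ_n‖e_n‖, the residual ‖Tx_n - x_n‖ by at most 2μ_n‖e_n‖, and ‖x_n - z‖² loses μ_n(1-μ_n)‖Tx_n -
x_n‖²/2 up to error terms. Since μ_n is independent of σ(e_n, x_0, …, x_n), conditioning on the past
replaces μ_n and μ_n(1-μ_n) by their means (`condExp_mul_eq_integral_mul`), so each inequality
becomes an almost supermartingale with perturbation governed by (Eμ_n)·`condError`.

Robbins–Siegmund (`ae_tendsto_and_summable_of_condExp_le`) then shows that, almost surely, the
distances and the residual norms converge and ∑ E(μ_n(1-μ_n))‖Tx_n - x_n‖² is finite. As ∑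
E(μ_n(1-μ_n)) diverges, the residual tends to 0 (`tendsto_zero_of_summable_mul`), and Opial's
argument over a countable dense subset of Fix T (`exists_weakTendsto_fixedPoint`) gives weak
convergence. Demiregularity makes it strong.

The hypotheses of (ii) imply both summability conditions needed above. They also yield a square
integrable majorant of all iterates (`exists_memLp_bound`), so that dominated convergence gives the
L¹ and weak L² statements. -/

theorem weakTendsto_iff_inner [CompleteSpace H] {u : ℕ → H} {a : H} :
    WeakTendsto u a ↔ ∀ h : H, Tendsto (fun n => ⟪h, u n⟫) atTop (𝓝 ⟪h, a⟫) := by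
  have hinj : Function.Injective ((topDualPairing ℝ H).flip) := by
    intro x y hxy
    refine ext_inner_left ℝ fun v => ?_
    have := DFunLike.congr_fun hxy (InnerProductSpace.toDual ℝ H v)
    simpa using this
  refine (WeakBilin.tendsto_iff_forall_eval_tendsto ((topDualPairing ℝ H).flip) hinj).trans ?_
  constructor
  · intro h v
    exact h (InnerProductSpace.toDual ℝ H v)
  · intro h f
    have := h ((InnerProductSpace.toDual ℝ H).symm f)
    simp only [InnerProductSpace.toDual_symm_apply] at this
    exact this

/-- A bounded family converges weakly along any ultrafilter. -/
theorem exists_inner_tendsto_of_ultrafilter [CompleteSpace H] {ι : Type*} (F : Ultrafilter ι)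
    {u : ι → H} {R : ℝ}
    (hu : ∀ i, ‖u i‖ ≤ R) : ∃ z : H, ∀ h : H, Tendsto (fun i => ⟪h, u i⟫) F (𝓝 ⟪h, z⟫) := by
  -- Banach–Alaoglu, transported by the Riesz isomorphism; along an ultrafilter compactness gives a
  -- limit without extracting subsequences.
  have hK := WeakDual.isCompact_closedBall (𝕜 := ℝ) (E := H) 0 R
  let v : ι → WeakDual ℝ H := fun i =>
    StrongDual.toWeakDual (InnerProductSpace.toDual ℝ H (u i))
  have hv : ∀ i, v i ∈ (WeakDual.toStrongDual ⁻¹' Metric.closedBall (0 : StrongDual ℝ H) R) := by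
    intro i
    simpa [v] using hu i
  obtain ⟨f, -, hf⟩ := hK.ultrafilter_le_nhds (F.map v)
    (le_principal_iff.2 (mem_map.2 (univ_mem' hv)))
  refine ⟨(InnerProductSpace.toDual ℝ H).symm (WeakDual.toStrongDual f), fun h => ?_⟩
  have h1 : Tendsto v F (𝓝 f) := hf
  have h2 := (tendsto_iff_forall_eval_tendsto_topDualPairing.1 h1) h
  have h3 : ⟪h, (InnerProductSpace.toDual ℝ H).symm (WeakDual.toStrongDual f)⟫ = f h := by
    rw [real_inner_comm]
    exact InnerProductSpace.toDual_symm_apply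
  rw [h3]
  refine Tendsto.congr (fun i => ?_) h2
  rw [real_inner_comm]
  rfl

/-- Demiclosedness principle: a weak limit of approximate fixed points of a nonexpansive operator
is a fixed point. -/
theorem isFixedPt_of_inner_tendsto {ι : Type*} {F : Filter ι} [F.NeBot] {T : H → H}
    (hT : LipschitzWith 1 T) {u : ι → H} {R : ℝ} (hu : ∀ i, ‖u i‖ ≤ R) {z : H}
    (hz : ∀ h : H, Tendsto (fun i => ⟪h, u i⟫) F (𝓝 ⟪h, z⟫))
    (hTu : Tendsto (fun i => T (u i) - u i) F (𝓝 0)) : T z = z := by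
  have hr : Tendsto (fun i => ‖T (u i) - u i‖) F (𝓝 0) := by simpa using hTu.norm
  have hin : Tendsto (fun i => ⟪z - T z, u i - z⟫) F (𝓝 0) := by
    have := (hz (z - T z)).sub_const ⟪z - T z, z⟫
    simpa [inner_sub_right] using this
  -- Expand ‖u i - T z‖² around z and compare with (‖T (u i) - u i‖ + ‖u i - z‖)²: the terms ‖u i -
  -- z‖² cancel, and what remains on the right tends to 0.
  have key : ∀ i, ‖z - T z‖ ^ 2 ≤
      ‖T (u i) - u i‖ ^ 2 + 2 * ‖T (u i) - u i‖ * (R + ‖z‖) - 2 * ⟪z - T z, u i - z⟫ := by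
    intro i
    have h1 : ‖u i - T z‖ ≤ ‖T (u i) - u i‖ + ‖u i - z‖ := by
      have h2 : ‖T (u i) - T z‖ ≤ ‖u i - z‖ := by
        simpa [dist_eq_norm] using hT.dist_le_mul (u i) z
      have h3 : u i - T z = -(T (u i) - u i) + (T (u i) - T z) := by abel
      rw [h3]
      refine (norm_add_le _ _).trans ?_
      rw [norm_neg]
      linarith
    have h4 : ‖u i - T z‖ ^ 2 = ‖u i - z‖ ^ 2 + 2 * ⟪z - T z, u i - z⟫ + ‖z - T z‖ ^ 2 := by
      have : u i - T z = (u i - z) + (z - T z) := by abel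
      rw [this, norm_add_sq_real, real_inner_comm]
    have h5 : ‖u i - z‖ ≤ R + ‖z‖ := (norm_sub_le _ _).trans (by linarith [hu i])
    have h6 : ‖u i - T z‖ ^ 2 ≤ (‖T (u i) - u i‖ + ‖u i - z‖) ^ 2 := by gcongr
    have h7 : ‖T (u i) - u i‖ * ‖u i - z‖ ≤ ‖T (u i) - u i‖ * (R + ‖z‖) := by gcongr
    nlinarith
  have hlim : Tendsto (fun i => ‖T (u i) - u i‖ ^ 2 + 2 * ‖T (u i) - u i‖ * (R + ‖z‖)
      - 2 * ⟪z - T z, u i - z⟫) F (𝓝 0) := by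
    have := ((hr.pow 2).add ((hr.const_mul 2).mul_const (R + ‖z‖))).sub (hin.const_mul 2)
    simpa using this
  have h0 : ‖z - T z‖ ^ 2 ≤ 0 := ge_of_tendsto' hlim key
  have h8 : ‖z - T z‖ = 0 := by
    have := sq_nonneg ‖z - T z‖
    exact pow_eq_zero_iff (two_ne_zero) |>.1 (le_antisymm h0 this)
  exact (sub_eq_zero.1 (norm_eq_zero.1 h8)).symm

/-- Opial-type lemma: a sequence of approximate fixed points of a nonexpansive operator whose
distances to the points of a dense subset of the fixed point set converge is weakly convergent
to a fixed point. -/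
theorem exists_weakTendsto_fixedPoint [CompleteSpace H] {T : H → H} (hT : LipschitzWith 1 T)
    {u : ℕ → H}
    {D : Set H} (hD : D.Nonempty) (hDF : Function.fixedPoints T ⊆ closure D)
    (hconv : ∀ d ∈ D, ∃ l, Tendsto (fun n => ‖u n - d‖) atTop (𝓝 l))
    (hTu : Tendsto (fun n => T (u n) - u n) atTop (𝓝 0)) :
    ∃ z ∈ Function.fixedPoints T, WeakTendsto u z := by
  obtain ⟨d₀, hd₀⟩ := hD
  obtain ⟨R, hR⟩ : ∃ R, ∀ n, ‖u n‖ ≤ R := by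
    obtain ⟨l, hl⟩ := hconv d₀ hd₀
    obtain ⟨C, hC⟩ := hl.bddAbove_range
    refine ⟨C + ‖d₀‖, fun n => ?_⟩
    have h1 : ‖u n - d₀‖ ≤ C := hC ⟨n, rfl⟩
    have h2 := norm_add_le (u n - d₀) d₀
    rw [sub_add_cancel] at h2
    linarith
  have hdiff : ∀ d ∈ D, ∀ d' ∈ D, ∃ l, Tendsto (fun n => ⟪d - d', u n⟫) atTop (𝓝 l) := by
    intro d hd d' hd'
    obtain ⟨l, hl⟩ := hconv d hd
    obtain ⟨l', hl'⟩ := hconv d' hd'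
    -- Polarization: ‖u n - d'‖² - ‖u n - d‖² is affine in ⟪d - d', u n⟫, because ‖u n‖² cancels.
    refine ⟨((l' ^ 2 - l ^ 2) + (‖d‖ ^ 2 - ‖d'‖ ^ 2)) / 2, ?_⟩
    refine ((((hl'.pow 2).sub (hl.pow 2)).add_const (‖d‖ ^ 2 - ‖d'‖ ^ 2)).div_const 2).congr ?_
    intro n
    rw [norm_sub_sq_real, norm_sub_sq_real, inner_sub_left, real_inner_comm d, real_inner_comm d']
    ring
  have hclus : ∀ F : Ultrafilter ℕ, (F : Filter ℕ) ≤ atTop →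
      ∃ z ∈ Function.fixedPoints T, ∀ h : H, Tendsto (fun i => ⟪h, u i⟫) F (𝓝 ⟪h, z⟫) := by
    intro F hF
    obtain ⟨z, hz⟩ := exists_inner_tendsto_of_ultrafilter F hR
    exact ⟨z, isFixedPt_of_inner_tendsto hT hR hz (hTu.mono_left hF), hz⟩
  -- The hyperfilter serves only to name one cluster point; every other ultrafilter is shown to give
  -- the same one.
  obtain ⟨z, hzF, hz⟩ := hclus (hyperfilter ℕ) Nat.hyperfilter_le_atTop
  refine ⟨z, hzF, weakTendsto_iff_inner.2 fun h => ?_⟩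
  rw [tendsto_iff_ultrafilter]
  intro G hG
  obtain ⟨w, hwF, hw⟩ := hclus G hG
  suffices hzw : z = w by rw [hzw]; exact hw h
  have hDD : ∀ d ∈ D, ∀ d' ∈ D, ⟪d - d', z - w⟫ = 0 := by
    intro d hd d' hd'
    obtain ⟨l, hl⟩ := hdiff d hd d' hd'
    have h1 := tendsto_nhds_unique (hl.mono_left Nat.hyperfilter_le_atTop) (hz (d - d'))
    have h2 := tendsto_nhds_unique (hl.mono_left hG) (hw (d - d'))
    rw [inner_sub_right, ← h1, ← h2, sub_self]
  -- Orthogonality extends to the closure by continuity, hence applies to the pair (z, w) of fixed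
  -- points itself.
  have hcl : closure D ×ˢ closure D ⊆ {p : H × H | ⟪p.1 - p.2, z - w⟫ = 0} := by
    rw [← closure_prod_eq]
    refine closure_minimal (fun p hp => hDD _ hp.1 _ hp.2) ?_
    exact isClosed_eq (by fun_prop) continuous_const
  have : ⟪z - w, z - w⟫ = 0 := hcl (show (z, w) ∈ _ from ⟨hDF hzF, hDF hwF⟩)
  exact sub_eq_zero.1 (inner_self_eq_zero.1 this)

theorem WeakTendsto.norm_le [CompleteSpace H] {u : ℕ → H} {a : H} (h : WeakTendsto u a) {C : ℝ}
    (hC : ∀ n, ‖u n‖ ≤ C) : ‖a‖ ≤ C := by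
  have h1 := weakTendsto_iff_inner.1 h a
  have h2 : ⟪a, a⟫ ≤ ‖a‖ * C := le_of_tendsto' h1 fun n =>
    (real_inner_le_norm _ _).trans (by gcongr; exact hC n)
  rw [real_inner_self_eq_norm_mul_norm] at h2
  rcases (norm_nonneg a).eq_or_lt with h0 | h0
  · rw [← h0]; exact (norm_nonneg _).trans (hC 0)
  · exact le_of_mul_le_mul_left h2 h0

/-- Weakly measurable maps into a separable Hilbert space are measurable. -/
theorem measurable_of_measurable_inner [TopologicalSpace.SeparableSpace H] [MeasurableSpace H]
    [BorelSpace H] {Ω : Type*} [MeasurableSpace Ω] {f : Ω → H}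
    (hf : ∀ h : H, Measurable fun ω => ⟪h, f ω⟫) : Measurable f := by
  have : SecondCountableTopology H := UniformSpace.secondCountable_of_separable H
  obtain ⟨s, hsc, hsd⟩ := TopologicalSpace.exists_countable_dense H
  have hball : ∀ (c : H) (r : ℝ), 0 ≤ r → MeasurableSet (f ⁻¹' Metric.closedBall c r) := by
    intro c r hr
    -- A closed ball is the intersection of the half-spaces containing it, and countably many
    -- directions suffice by density.
    have heq : f ⁻¹' Metric.closedBall c r =
        ⋂ h ∈ s, {ω | ⟪h, f ω⟫ - ⟪h, c⟫ ≤ ‖h‖ * r} := by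
      ext ω
      simp only [Set.mem_preimage, Metric.mem_closedBall, dist_eq_norm, Set.mem_iInter,
        Set.mem_ofPred_eq, ← inner_sub_right]
      constructor
      · intro h v _
        exact (real_inner_le_norm _ _).trans (by gcongr)
      · intro h
        have hall : ∀ v : H, ⟪v, f ω - c⟫ ≤ ‖v‖ * r := by
          intro v
          have hcl : IsClosed {v : H | ⟪v, f ω - c⟫ ≤ ‖v‖ * r} :=
            isClosed_le (by fun_prop) (by fun_prop)
          exact hcl.closure_subset_iff.2 h (hsd v)
        have h1 := hall (f ω - c)
        rw [real_inner_self_eq_norm_mul_norm] at h1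
        rcases (norm_nonneg (f ω - c)).eq_or_lt with h0 | h0
        · rwa [← h0]
        · exact le_of_mul_le_mul_left h1 h0
    rw [heq]
    exact MeasurableSet.biInter hsc fun h _ =>
      measurableSet_le ((hf h).sub_const _) measurable_const
  refine measurable_of_isOpen fun U hU => ?_
  have hU' : U = ⋃ c ∈ s, ⋃ k ∈ {k : ℕ | Metric.closedBall c (1 / (k + 1 : ℝ)) ⊆ U},
      Metric.closedBall c (1 / (k + 1 : ℝ)) := by
    refine Set.Subset.antisymm (fun y hy => ?_) ?_
    · obtain ⟨ε, hε, hεU⟩ := Metric.isOpen_iff.1 hU y hy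
      obtain ⟨k, hk⟩ := exists_nat_one_div_lt (half_pos hε)
      obtain ⟨c, hcs, hc⟩ := hsd.exists_dist_lt y (Nat.one_div_pos_of_nat (α := ℝ) (n := k))
      simp only [Set.mem_iUnion]
      refine ⟨c, hcs, k, fun w hw => hεU ?_, hc.le⟩
      have : dist w y ≤ dist w c + dist c y := dist_triangle _ _ _
      rw [dist_comm c y] at this
      have hw' : dist w c ≤ 1 / (k + 1 : ℝ) := hw
      rw [Metric.mem_ball]
      linarith
    · exact Set.iUnion₂_subset fun c _ => Set.iUnion₂_subset fun k hk => hk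
  rw [hU']
  simp only [Set.preimage_iUnion]
  exact MeasurableSet.biUnion hsc fun c _ => MeasurableSet.biUnion (Set.to_countable _) fun k _ =>
    hball c _ (by positivity)

/-- If almost every path of a random sequence converges weakly to some point of a nonempty set `S`,
then a weak limit can be selected to be measurable and to lie everywhere in `S`. -/
theorem exists_measurable_weakTendsto [CompleteSpace H]
    [TopologicalSpace.SeparableSpace H] [MeasurableSpace H] [BorelSpace H]
    {Ω : Type*} [MeasurableSpace Ω] {P : Measure Ω} {S : Set H} (hS : S.Nonempty)
    {x : ℕ → Ω → H} (hx : ∀ n, Measurable (x n))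
    (h : ∀ᵐ ω ∂P, ∃ z ∈ S, WeakTendsto (fun n => x n ω) z) :
    ∃ y : Ω → H, Measurable y ∧ (∀ ω, y ω ∈ S) ∧
      ∀ᵐ ω ∂P, WeakTendsto (fun n => x n ω) (y ω) := by
  classical
  obtain ⟨z₀, hz₀⟩ := hS
  -- A measurable null set covering the bad event. Freezing the sequence at `z₀` on it makes weak
  -- convergence hold everywhere, so measurability passes to the limit.
  set B : Set Ω := toMeasurable P {ω | ¬∃ z ∈ S, WeakTendsto (fun n => x n ω) z} with hB
  have hBm : MeasurableSet B := measurableSet_toMeasurable _ _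
  have hB0 : P B = 0 := by rw [hB, measure_toMeasurable]; exact h
  have hex : ∀ ω, ∃ z ∈ S, ω ∉ B → WeakTendsto (fun n => x n ω) z := by
    intro ω
    by_cases hω : ω ∈ B
    · exact ⟨z₀, hz₀, fun hn => absurd hω hn⟩
    · have h1 : ω ∉ {ω | ¬∃ z ∈ S, WeakTendsto (fun n => x n ω) z} :=
        fun hn => hω (subset_toMeasurable _ _ hn)
      obtain ⟨z, hz, hzw⟩ := not_not.1 h1
      exact ⟨z, hz, fun _ => hzw⟩
  choose f hfS hf using hex
  refine ⟨fun ω => if ω ∈ B then z₀ else f ω, ?_, ?_, ?_⟩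
  · refine measurable_of_measurable_inner fun v => ?_
    refine measurable_of_tendsto_metrizable
      (f := fun (n : ℕ) ω => ⟪v, if ω ∈ B then z₀ else x n ω⟫) (fun n => ?_) ?_
    · have : Measurable fun ω => if ω ∈ B then z₀ else x n ω :=
        Measurable.ite hBm measurable_const (hx n)
      exact (innerSL ℝ v).continuous.measurable.comp this
    · rw [tendsto_pi_nhds]
      intro ω
      by_cases hω : ω ∈ B
      · simp [hω]
      · simpa [hω] using weakTendsto_iff_inner.1 (hf ω hω) v
  · intro ω
    by_cases hω : ω ∈ B
    · simpa [hω] using hz₀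
    · simpa [hω] using hfS ω
  · have : ∀ᵐ ω ∂P, ω ∉ B := measure_eq_zero_iff_ae_notMem.1 hB0
    filter_upwards [this] with ω hω
    simpa [hω] using hf ω hω

end Weak

/-! ### Divergent weights force a zero limit. -/

section Scalar

/-- If `∑ c n = ∞`, `∑ c n * a n < ∞` and `a` converges, then its limit is zero. -/
theorem tendsto_zero_of_summable_mul {a c : ℕ → ℝ} (hc : ∀ n, 0 ≤ c n)
    (hdiv : Tendsto (fun N => ∑ n ∈ Finset.range N, c n) atTop atTop)
    (hs : Summable fun n => c n * a n) {l : ℝ} (hl : 0 ≤ l) (ha : Tendsto a atTop (𝓝 l)) :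
    l = 0 := by
  by_contra hne
  have hpos : 0 < l := lt_of_le_of_ne hl (Ne.symm hne)
  have hev : ∀ᶠ n in atTop, l / 2 ≤ a n :=
    (ha.eventually (lt_mem_nhds (half_lt_self hpos))).mono fun n hn => le_of_lt hn
  have hcs : Summable c := by
    have h1 : Summable fun n => (l / 2)⁻¹ * (c n * a n) := hs.mul_left _
    refine summable_of_isBigO_nat h1 (Asymptotics.IsBigO.of_bound 1 ?_)
    filter_upwards [hev] with n hn
    have h2 : c n ≤ (l / 2)⁻¹ * (c n * a n) := by
      rw [inv_mul_eq_div, le_div_iff₀ (half_pos hpos)]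
      exact mul_le_mul_of_nonneg_left hn (hc n)
    rw [one_mul, Real.norm_of_nonneg (hc n), Real.norm_of_nonneg ((hc n).trans h2)]
    exact h2
  exact not_tendsto_nhds_of_tendsto_atTop hdiv _ hcs.hasSum.tendsto_sum_nat

end Scalar

/-! ### Deterministic inequalities for one relaxed step. -/

section Step

variable {H : Type*} [NormedAddCommGroup H] [InnerProductSpace ℝ H]

variable {T : H → H} {u v e z : H} {μ : ℝ}

/-- `v - z` is a convex combination of `u - z` and `T u - z`, plus `μ • e`. -/
theorem norm_step_sub_le (hT : LipschitzWith 1 T) (hz : T z = z) (h0 : 0 ≤ μ) (h1 : μ ≤ 1)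
    (hv : v = u + μ • (T u + e - u)) : ‖v - z‖ ≤ ‖u - z‖ + μ * ‖e‖ := by
  have h2 : ‖T u - z‖ ≤ ‖u - z‖ := by
    simpa [dist_eq_norm, hz] using hT.dist_le_mul u z
  have h3 : v - z = (1 - μ) • (u - z) + μ • (T u - z) + μ • e := by
    rw [hv]; module
  rw [h3]
  refine (norm_add₃_le).trans ?_
  rw [norm_smul, norm_smul, norm_smul, Real.norm_of_nonneg h0,
    Real.norm_of_nonneg (sub_nonneg.2 h1)]
  nlinarith

/-- Split at `T u`: ‖T v - T u‖ contributes μ‖T u - u‖ and ‖T u - v‖ contributes (1-μ)‖T u - u‖, and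
each costs one further μ‖e‖. -/
theorem norm_step_residual_le (hT : LipschitzWith 1 T) (h0 : 0 ≤ μ) (h1 : μ ≤ 1)
    (hv : v = u + μ • (T u + e - u)) : ‖T v - v‖ ≤ ‖T u - u‖ + μ * (2 * ‖e‖) := by
  have h2 : ‖T v - T u‖ ≤ ‖v - u‖ := by
    simpa [dist_eq_norm] using hT.dist_le_mul v u
  have h3 : ‖v - u‖ ≤ μ * ‖T u - u‖ + μ * ‖e‖ := by
    have : v - u = μ • (T u - u) + μ • e := by rw [hv]; module
    rw [this]
    refine (norm_add_le _ _).trans ?_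
    rw [norm_smul, norm_smul, Real.norm_of_nonneg h0]
  have h4 : ‖T u - v‖ ≤ (1 - μ) * ‖T u - u‖ + μ * ‖e‖ := by
    have : T u - v = (1 - μ) • (T u - u) - μ • e := by rw [hv]; module
    rw [this]
    refine (norm_sub_le _ _).trans ?_
    rw [norm_smul, norm_smul, Real.norm_of_nonneg h0, Real.norm_of_nonneg (sub_nonneg.2 h1)]
  have h5 : T v - v = (T v - T u) + (T u - v) := by abel
  rw [h5]
  refine (norm_add_le _ _).trans ?_
  linarith

/-- The identity for the squared norm of a convex combination has the gain μ(1-μ)‖T u + e - u‖².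
Trading it for the exact residual through (a+b)² ≤ 2a² + 2b² costs the factor 1/2 and a second
μ‖e‖². -/
theorem norm_step_sub_sq_le (hT : LipschitzWith 1 T) (hz : T z = z) (h0 : 0 ≤ μ) (h1 : μ ≤ 1)
    (hv : v = u + μ • (T u + e - u)) :
    ‖v - z‖ ^ 2 + μ * (1 - μ) * (‖T u - u‖ ^ 2 / 2) ≤
      ‖u - z‖ ^ 2 + μ * (2 * ‖u - z‖ * ‖e‖ + 2 * ‖e‖ ^ 2) := by
  have h2 : ‖T u - z‖ ≤ ‖u - z‖ := by
    simpa [dist_eq_norm, hz] using hT.dist_le_mul u z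
  have h3 : ‖T u + e - z‖ ≤ ‖u - z‖ + ‖e‖ := by
    have : T u + e - z = (T u - z) + e := by abel
    rw [this]
    exact (norm_add_le _ _).trans (by gcongr)
  have h4 : ‖T u + e - z‖ ^ 2 ≤ (‖u - z‖ + ‖e‖) ^ 2 := by gcongr
  have h5 : ‖v - z‖ ^ 2 = (1 - μ) * ‖u - z‖ ^ 2 + μ * ‖T u + e - z‖ ^ 2
      - μ * (1 - μ) * ‖T u + e - u‖ ^ 2 := by
    have ha : v - z = (u - z) + μ • (T u + e - u) := by rw [hv]; abel
    have hb : T u + e - z = (u - z) + (T u + e - u) := by abel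
    rw [ha, hb, norm_add_sq_real, norm_add_sq_real, norm_smul, inner_smul_right,
      Real.norm_of_nonneg h0]
    ring
  have h6 : ‖T u - u‖ ^ 2 ≤ 2 * ‖T u + e - u‖ ^ 2 + 2 * ‖e‖ ^ 2 := by
    have : T u - u = (T u + e - u) - e := by abel
    have h7 : ‖T u - u‖ ≤ ‖T u + e - u‖ + ‖e‖ := by
      rw [this]; exact norm_sub_le _ _
    have h8 : ‖T u - u‖ ^ 2 ≤ (‖T u + e - u‖ + ‖e‖) ^ 2 := by gcongr
    nlinarith [sq_nonneg (‖T u + e - u‖ - ‖e‖)]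
  have h9 : 0 ≤ μ * (1 - μ) := mul_nonneg h0 (sub_nonneg.2 h1)
  have h10 := mul_le_mul_of_nonneg_left h6 h9
  have h11 := mul_le_mul_of_nonneg_left h4 h0
  have h12 : μ * (1 - μ) * ‖e‖ ^ 2 ≤ μ * ‖e‖ ^ 2 := by
    have : μ * (1 - μ) ≤ μ := by nlinarith
    gcongr
  nlinarith

end Step

/-! ### Almost supermartingale convergence. -/

section RobbinsSiegmund

variable {Ω : Type*} {m₀ : MeasurableSpace Ω} {P : Measure Ω} [IsProbabilityMeasure P]
  {ℱ : Filtration ℕ m₀} {Z a b : ℕ → Ω → ℝ}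

/-- Robbins–Siegmund theorem with uniformly bounded perturbation sums. -/
theorem ae_tendsto_and_summable_of_condExp_le_of_sum_le {K : ℝ}
    (hZm : ∀ n, StronglyMeasurable[ℱ n] (Z n)) (ham : ∀ n, StronglyMeasurable[ℱ n] (a n))
    (hbm : ∀ n, StronglyMeasurable[ℱ n] (b n))
    (hZi : ∀ n, Integrable (Z n) P) (hai : ∀ n, Integrable (a n) P)
    (hbi : ∀ n, Integrable (b n) P)
    (hZ : ∀ n ω, 0 ≤ Z n ω) (ha : ∀ n ω, 0 ≤ a n ω) (hb : ∀ n ω, 0 ≤ b n ω)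
    (h : ∀ n, P[Z (n + 1) | ℱ n] ≤ᵐ[P] fun ω => Z n ω + a n ω - b n ω)
    (hK : ∀ n ω, ∑ k ∈ Finset.range n, a k ω ≤ K) :
    ∀ᵐ ω ∂P, (∃ l, Tendsto (fun n => Z n ω) atTop (𝓝 l)) ∧ Summable fun n => b n ω := by
  -- Adding the compensator turns `Z` into a supermartingale; the constant `K` makes it nonnegative.
  let D : ℕ → Ω → ℝ := fun n ω => ∑ k ∈ Finset.range n, (b k ω - a k ω) + K
  let M : ℕ → Ω → ℝ := fun n => Z n + D n
  -- The bound `i + 1` expresses predictability: the sum in `D (n + 1)` stops at index n.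
  have hDm : ∀ n i, n ≤ i + 1 → StronglyMeasurable[ℱ i] (D n) := by
    intro n i hni
    refine StronglyMeasurable.add ?_ stronglyMeasurable_const
    refine Finset.stronglyMeasurable_fun_sum _ fun k hk => ?_
    have hki : k ≤ i := by have := Finset.mem_range.1 hk; omega
    exact ((hbm k).mono (ℱ.mono hki)).sub ((ham k).mono (ℱ.mono hki))
  have hDi : ∀ n, Integrable (D n) P := fun n =>
    (integrable_finsetSum _ fun k _ => (hbi k).sub (hai k)).add (integrable_const K)
  have hMi : ∀ n, Integrable (M n) P := fun n => (hZi n).add (hDi n)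
  have hM0 : ∀ n ω, ∑ k ∈ Finset.range n, b k ω ≤ M n ω := by
    intro n ω
    have h1 := hK n ω
    have h2 := hZ n ω
    simp only [M, D, Pi.add_apply, Finset.sum_sub_distrib]
    linarith
  have hMnn : ∀ n ω, 0 ≤ M n ω := fun n ω =>
    (Finset.sum_nonneg fun k _ => hb k ω).trans (hM0 n ω)
  have hsuper : Supermartingale M ℱ P := by
    refine supermartingale_nat (fun n => (hZm n).add (hDm n n (by omega))) hMi fun n => ?_
    have h1 := condExp_add (hZi (n + 1)) (hDi (n + 1)) (ℱ n)
    have h2 := condExp_of_stronglyMeasurable (μ := P) (ℱ.le n) (hDm (n + 1) n le_rfl) (hDi (n + 1))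
    filter_upwards [h1, h n] with ω h3 h4
    change (P[Z (n + 1) + D (n + 1) | ℱ n]) ω ≤ _
    rw [h3, Pi.add_apply, h2]
    simp only [M, D, Pi.add_apply, Finset.sum_range_succ]
    linarith
  -- A nonnegative supermartingale has L¹ norms bounded by its initial mean.
  have hbdd : ∀ n, eLpNorm ((-M) n) 1 P ≤ (∫ ω, M 0 ω ∂P).toNNReal := by
    intro n
    rw [Pi.neg_apply, eLpNorm_neg, eLpNorm_one_eq_lintegral_enorm,
      ← ofReal_integral_norm_eq_lintegral_enorm (hMi n)]
    refine ENNReal.ofReal_le_ofReal ?_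
    have h1 : ∫ ω, ‖M n ω‖ ∂P = ∫ ω, M n ω ∂P := by
      congr 1
      ext ω
      exact Real.norm_of_nonneg (hMnn n ω)
    rw [h1]
    simpa using hsuper.setIntegral_le (Nat.zero_le n) MeasurableSet.univ
  have hconv := hsuper.neg.exists_ae_tendsto_of_bdd hbdd
  filter_upwards [hconv] with ω hω
  obtain ⟨c, hc⟩ := hω
  have hMc : Tendsto (fun n => M n ω) atTop (𝓝 (-c)) := by
    simpa using hc.neg
  have hbs : Summable fun n => b n ω := by
    obtain ⟨C, hC⟩ := hMc.bddAbove_range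
    exact summable_of_sum_range_le (fun n => hb n ω) fun n => (hM0 n ω).trans (hC ⟨n, rfl⟩)
  have has : Summable fun n => a n ω :=
    summable_of_sum_range_le (fun n => ha n ω) fun n => hK n ω
  have hlim := (hMc.sub ((hbs.sub has).hasSum.tendsto_sum_nat)).sub_const K
  refine ⟨⟨_, hlim.congr fun n => ?_⟩, hbs⟩
  simp only [M, D, Pi.add_apply]
  ring

/-- **Robbins–Siegmund theorem.** -/
theorem ae_tendsto_and_summable_of_condExp_le
    (hZm : ∀ n, StronglyMeasurable[ℱ n] (Z n)) (ham : ∀ n, StronglyMeasurable[ℱ n] (a n))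
    (hbm : ∀ n, StronglyMeasurable[ℱ n] (b n))
    (hZi : ∀ n, Integrable (Z n) P) (hai : ∀ n, Integrable (a n) P)
    (hbi : ∀ n, Integrable (b n) P)
    (hZ : ∀ n ω, 0 ≤ Z n ω) (ha : ∀ n ω, 0 ≤ a n ω) (hb : ∀ n ω, 0 ≤ b n ω)
    (h : ∀ n, P[Z (n + 1) | ℱ n] ≤ᵐ[P] fun ω => Z n ω + a n ω - b n ω)
    (hs : ∀ᵐ ω ∂P, Summable fun n => a n ω) :
    ∀ᵐ ω ∂P, (∃ l, Tendsto (fun n => Z n ω) atTop (𝓝 l)) ∧ Summable fun n => b n ω := by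
  -- Localization: the process is killed once the perturbation sum exceeds K. Including the term `a
  -- n` keeps the event in `ℱ n` and bounds the truncated sums by K.
  let A : ℕ → ℕ → Set Ω := fun K n => {ω | ∑ k ∈ Finset.range (n + 1), a k ω ≤ K}
  have hAm : ∀ K n, MeasurableSet[ℱ n] (A K n) := by
    intro K n
    have h1 : StronglyMeasurable[ℱ n] fun ω => ∑ k ∈ Finset.range (n + 1), a k ω :=
      Finset.stronglyMeasurable_fun_sum _ fun k hk =>
        (ham k).mono (ℱ.mono (Nat.lt_succ_iff.1 (Finset.mem_range.1 hk)))
    exact h1.measurable measurableSet_Iic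
  have hAanti : ∀ K n, A K (n + 1) ⊆ A K n := by
    intro K n ω hω
    refine le_trans ?_ (show ∑ k ∈ Finset.range (n + 1 + 1), a k ω ≤ K from hω)
    rw [Finset.sum_range_succ _ (n + 1)]
    linarith [ha (n + 1) ω]
  have hK : ∀ K : ℕ, ∀ᵐ ω ∂P,
      (∃ l, Tendsto (fun n => (A K n).indicator (Z n) ω) atTop (𝓝 l)) ∧
        Summable fun n => (A K n).indicator (b n) ω := by
    intro K
    refine ae_tendsto_and_summable_of_condExp_le_of_sum_le (ℱ := ℱ) (K := K)
      (a := fun n => (A K n).indicator (a n))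
      (fun n => (hZm n).indicator (hAm K n)) (fun n => (ham n).indicator (hAm K n))
      (fun n => (hbm n).indicator (hAm K n))
      (fun n => (hZi n).indicator (ℱ.le n _ (hAm K n)))
      (fun n => (hai n).indicator (ℱ.le n _ (hAm K n)))
      (fun n => (hbi n).indicator (ℱ.le n _ (hAm K n)))
      (fun n => Set.indicator_nonneg fun ω _ => hZ n ω)
      (fun n => Set.indicator_nonneg fun ω _ => ha n ω)
      (fun n => Set.indicator_nonneg fun ω _ => hb n ω) (fun n => ?_) (fun n ω => ?_)
    · have h1 : P[(A K (n + 1)).indicator (Z (n + 1)) | ℱ n] ≤ᵐ[P]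
          P[(A K n).indicator (Z (n + 1)) | ℱ n] :=
        condExp_mono ((hZi _).indicator (ℱ.le _ _ (hAm K _)))
          ((hZi _).indicator (ℱ.le _ _ (hAm K _)))
          (.of_forall fun ω => Set.indicator_le_indicator_of_subset (hAanti K n)
            (fun ω => hZ (n + 1) ω) ω)
      have h2 := condExp_indicator (hZi (n + 1)) (hAm K n)
      filter_upwards [h1, h2, h n] with ω h1 h2 h3
      rw [h2] at h1
      refine h1.trans ?_
      by_cases hω : ω ∈ A K n
      · simpa [hω] using h3
      · simp [hω]
    · induction n with
      | zero => simp
      | succ n ih =>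
        by_cases hω : ω ∈ A K n
        · refine le_trans (Finset.sum_le_sum fun k _ => ?_) hω
          exact Set.indicator_le_self' (fun _ _ => ha k ω) ω
        · rw [Finset.sum_range_succ, Set.indicator_of_notMem hω, add_zero]
          exact ih
  -- On almost every path some integer K bounds the whole series, so truncation at that K never
  -- acts.
  filter_upwards [ae_all_iff.2 hK, hs] with ω hω hsω
  obtain ⟨K, hKω⟩ := exists_nat_ge (∑' n, a n ω)
  have hmem : ∀ n, ω ∈ A K n := fun n =>
    (hsω.sum_le_tsum _ fun k _ => ha k ω).trans hKω
  simpa [hmem] using hω K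

end RobbinsSiegmund

/-! ### Conditional expectations under independence. -/

section Indep

variable {Ω : Type*} {m₀ : MeasurableSpace Ω} {P : Measure Ω} [IsProbabilityMeasure P]

/-- A bounded factor independent of a larger σ-algebra, with respect to which the other factor is
measurable, can be replaced by its mean inside a conditional expectation. -/
theorem condExp_mul_eq_integral_mul {m m₁ m₂ : MeasurableSpace Ω} (hm : m ≤ m₂) (hm₁ : m₁ ≤ m₀)
    (hm₂ : m₂ ≤ m₀) (hind : Indep m₁ m₂ P) {f g : Ω → ℝ} (hf : StronglyMeasurable[m₁] f)
    (hfi : Integrable f P) {C : ℝ} (hfC : ∀ᵐ ω ∂P, ‖f ω‖ ≤ C)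
    (hg : StronglyMeasurable[m₂] g) (hgi : Integrable g P) :
    P[fun ω => f ω * g ω | m] =ᵐ[P] fun ω => (∫ ω', f ω' ∂P) * (P[g | m]) ω := by
  have hfg : Integrable (f * g) P := hgi.bdd_mul hfi.aestronglyMeasurable hfC
  -- Conditioning first on `m₂` pulls out `g` and averages `f`; the tower property then descends to
  -- `m`.
  have h1 : P[f * g | m₂] =ᵐ[P] (∫ ω', f ω' ∂P) • g := by
    filter_upwards [condExp_mul_of_stronglyMeasurable_right hg hfg hfi,
      condExp_indep_eq hm₁ hm₂ hf hind] with ω h2 h3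
    rw [h2, Pi.mul_apply, h3, Pi.smul_apply, smul_eq_mul]
  have h4 : P[P[f * g | m₂] | m] =ᵐ[P] P[f * g | m] := condExp_condExp_of_le hm hm₂
  have h5 : P[P[f * g | m₂] | m] =ᵐ[P] P[(∫ ω', f ω' ∂P) • g | m] := condExp_congr_ae h1
  have h6 := condExp_smul (μ := P) (∫ ω', f ω' ∂P) g m
  filter_upwards [h4, h5, h6] with ω h4 h5 h6
  change (P[f * g | m]) ω = _
  rw [← h4, h5, h6, Pi.smul_apply, smul_eq_mul]

/-- Conditional Cauchy–Schwarz (Jensen) inequality for the norm. -/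
theorem condExp_norm_le_sqrt {m : MeasurableSpace Ω} (hm : m ≤ m₀) {f : Ω → ℝ}
    (hf : MemLp f 2 P) :
    P[f | m] ≤ᵐ[P] fun ω => √((P[fun ω' => f ω' ^ 2 | m]) ω) := by
  have h1 := ConvexOn.map_condExp_le (μ := P) (s := Set.univ) (φ := fun t : ℝ => t ^ 2) hm
    (even_two.convexOn_pow)
    ((by fun_prop : Continuous fun t : ℝ => t ^ 2).lowerSemicontinuous.lowerSemicontinuousOn _)
    (.of_forall fun _ => Set.mem_univ (f _)) isClosed_univ (hf.integrable one_le_two)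
    hf.integrable_sq
  filter_upwards [h1] with ω h2
  exact Real.le_sqrt_of_sq_le h2

end Indep

/-! ### Series in L² and dominated convergence. -/

section Integration

variable {Ω : Type*} {m₀ : MeasurableSpace Ω} {P : Measure Ω}

theorem ae_summable_of_summable_integral {f : ℕ → Ω → ℝ} (hf : ∀ n, Integrable (f n) P)
    (h0 : ∀ n, 0 ≤ᵐ[P] f n) (hs : Summable fun n => ∫ ω, f n ω ∂P) :
    ∀ᵐ ω ∂P, Summable fun n => f n ω := by
  have hm : ∀ n, AEMeasurable (fun ω => ENNReal.ofReal (f n ω)) P := fun n =>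
    (hf n).aestronglyMeasurable.aemeasurable.ennreal_ofReal
  have h1 : ∫⁻ ω, ∑' n, ENNReal.ofReal (f n ω) ∂P ≠ ⊤ := by
    rw [lintegral_tsum hm]
    have h2 : ∀ n, ∫⁻ ω, ENNReal.ofReal (f n ω) ∂P = ENNReal.ofReal (∫ ω, f n ω ∂P) :=
      fun n => (ofReal_integral_eq_lintegral_ofReal (hf n) (h0 n)).symm
    simp_rw [h2]
    rw [← ENNReal.ofReal_tsum_of_nonneg (fun n => integral_nonneg_of_ae (h0 n)) hs]
    exact ENNReal.ofReal_ne_top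
  filter_upwards [ae_lt_top' (AEMeasurable.tsum hm) h1, ae_all_iff.2 h0] with ω h3 h4
  refine (ENNReal.summable_toReal h3.ne).congr fun n => ?_
  exact ENNReal.toReal_ofReal (h4 n)

theorem integral_le_sqrt_integral_sq [IsProbabilityMeasure P] {f : Ω → ℝ} (hf : MemLp f 2 P) :
    ∫ ω, f ω ∂P ≤ √(∫ ω, f ω ^ 2 ∂P) := by
  refine Real.le_sqrt_of_sq_le ?_
  have h1 := variance_nonneg f P
  rw [variance_eq_sub hf] at h1
  simpa using h1

theorem eLpNorm_two_eq_ofReal_sqrt {f : Ω → ℝ} (hf : MemLp f 2 P) :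
    eLpNorm f 2 P = ENNReal.ofReal √(∫ ω, f ω ^ 2 ∂P) := by
  rw [hf.eLpNorm_eq_integral_rpow_norm two_ne_zero ENNReal.ofNat_ne_top, Real.sqrt_eq_rpow]
  simp

/-- A series of nonnegative functions that converges absolutely in `L²` converges almost
everywhere, and its sum is in `L²`. -/
theorem ae_summable_and_memLp_tsum [IsProbabilityMeasure P] {f : ℕ → Ω → ℝ}
    (hf : ∀ n, MemLp (f n) 2 P)
    (h0 : ∀ n, 0 ≤ᵐ[P] f n) (hs : Summable fun n => √(∫ ω, f n ω ^ 2 ∂P)) :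
    (∀ᵐ ω ∂P, Summable fun n => f n ω) ∧ MemLp (fun ω => ∑' n, f n ω) 2 P := by
  have h1 : ∀ᵐ ω ∂P, Summable fun n => f n ω :=
    ae_summable_of_summable_integral (fun n => (hf n).integrable one_le_two) h0
      (hs.of_nonneg_of_le (fun n => integral_nonneg_of_ae (h0 n))
        fun n => integral_le_sqrt_integral_sq (hf n))
  have hlim : ∀ᵐ ω ∂P, Tendsto (fun N => (∑ n ∈ Finset.range N, f n) ω) atTop
      (𝓝 (∑' n, f n ω)) := by
    filter_upwards [h1] with ω hω
    simpa using hω.hasSum.tendsto_sum_nat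
  have hSm : ∀ N, AEStronglyMeasurable (∑ n ∈ Finset.range N, f n) P := fun N =>
    Finset.aestronglyMeasurable_sum _ fun n _ => (hf n).aestronglyMeasurable
  refine ⟨h1, aestronglyMeasurable_of_tendsto_ae atTop hSm hlim, ?_⟩
  -- Fatou for the L² norm, with partial sums bounded by Minkowski's inequality.
  refine (Lp.eLpNorm_lim_le_liminf_eLpNorm hSm _ hlim).trans_lt ?_
  have hbd : ∀ N, eLpNorm (∑ n ∈ Finset.range N, f n) 2 P ≤
      ENNReal.ofReal (∑' n, √(∫ ω, f n ω ^ 2 ∂P)) := by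
    intro N
    refine (eLpNorm_sum_le (fun n _ => (hf n).aestronglyMeasurable) one_le_two).trans ?_
    simp_rw [fun n => eLpNorm_two_eq_ofReal_sqrt (hf n)]
    rw [← ENNReal.ofReal_sum_of_nonneg fun n _ => Real.sqrt_nonneg _]
    exact ENNReal.ofReal_le_ofReal (hs.sum_le_tsum _ fun n _ => Real.sqrt_nonneg _)
  refine lt_of_le_of_lt ?_ (ENNReal.ofReal_lt_top (r := ∑' n, √(∫ ω, f n ω ^ 2 ∂P)))
  exact liminf_le_of_le (by isBoundedDefault) fun b hb => by
    obtain ⟨N, hN⟩ := hb.exists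
    exact hN.trans (hbd N)

variable {H : Type*} [NormedAddCommGroup H]

theorem tendstoInL1_of_dominated {y : ℕ → Ω → H} {z : Ω → H} {G : Ω → ℝ}
    (hy : ∀ n, AEStronglyMeasurable (y n) P) (hG : Integrable G P)
    (hyG : ∀ n, ∀ᵐ ω ∂P, ‖y n ω‖ ≤ G ω)
    (hlim : ∀ᵐ ω ∂P, Tendsto (fun n => y n ω) atTop (𝓝 (z ω))) : TendstoInL1 P y z := by
  refine ⟨fun n => memLp_one_iff_integrable.2 (hG.mono' (hy n) (hyG n)),
    memLp_one_iff_integrable.2 (hG.mono' (aestronglyMeasurable_of_tendsto_ae atTop hy hlim) ?_), ?_⟩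
  · filter_upwards [ae_all_iff.2 hyG, hlim] with ω h1 h2
    exact le_of_tendsto' h2.norm h1
  · have h1 := tendsto_lintegral_norm_of_dominated_convergence hy hG.hasFiniteIntegral hyG hlim
    simpa only [eLpNorm_one_eq_lintegral_enorm, ofReal_norm] using h1

/-- Against a test function h in L², the pairings converge pointwise and are dominated by ‖h‖G, a
product of two L² functions. -/
theorem weakTendstoInL2_of_dominated [InnerProductSpace ℝ H] [CompleteSpace H]
    {y : ℕ → Ω → H} {z : Ω → H} {G : Ω → ℝ}
    (hy : ∀ n, AEStronglyMeasurable (y n) P) (hz : AEStronglyMeasurable z P) (hG : MemLp G 2 P)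
    (hyG : ∀ n, ∀ᵐ ω ∂P, ‖y n ω‖ ≤ G ω)
    (hlim : ∀ᵐ ω ∂P, WeakTendsto (fun n => y n ω) (z ω)) : WeakTendstoInL2 P y z := by
  have hzG : ∀ᵐ ω ∂P, ‖z ω‖ ≤ G ω := by
    filter_upwards [ae_all_iff.2 hyG, hlim] with ω h1 h2
    exact h2.norm_le h1
  have hle : ∀ {w : Ω → H}, AEStronglyMeasurable w P → (∀ᵐ ω ∂P, ‖w ω‖ ≤ G ω) → MemLp w 2 P :=
    fun hw hwG => hG.of_le hw (hwG.mono fun ω h => h.trans (le_abs_self _))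
  have hy2 := fun n => hle (hy n) (hyG n)
  have hz2 := hle hz hzG
  refine ⟨hy2, hz2, weakTendsto_iff_inner.2 fun h => ?_⟩
  have hcongr : ∀ {w : Ω → H} (hw : MemLp w 2 P), ⟪h, hw.toLp w⟫ = ∫ ω, ⟪h ω, w ω⟫ ∂P := by
    intro w hw
    rw [L2.inner_def]
    refine integral_congr_ae ?_
    filter_upwards [hw.coeFn_toLp] with ω hω
    rw [hω]
  rw [hcongr hz2]
  simp_rw [fun n => hcongr (hy2 n)]
  have hh : MemLp h 2 P := Lp.memLp h
  refine tendsto_integral_of_dominated_convergence (fun ω => ‖h ω‖ * G ω)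
    (fun n => hh.aestronglyMeasurable.inner (hy n)) (hh.norm.integrable_mul hG) (fun n => ?_) ?_
  · filter_upwards [hyG n] with ω hω
    refine (norm_inner_le_norm _ _).trans ?_
    gcongr
  · filter_upwards [hlim] with ω hω
    exact weakTendsto_iff_inner.1 hω (h ω)

end Integration

/-! ### Robbins–Siegmund for random relaxations. -/

section StochasticStep

variable {Ω : Type*} {m₀ : MeasurableSpace Ω} {P : Measure Ω} [IsProbabilityMeasure P]

theorem integrable_of_ae_mem_Ioo {μ : Ω → ℝ} (hm : Measurable μ)
    (hμ : ∀ᵐ ω ∂P, μ ω ∈ Set.Ioo (0 : ℝ) 1) : Integrable μ P :=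
  Integrable.of_bound hm.aestronglyMeasurable 1
    (hμ.mono fun ω h => by rw [Real.norm_of_nonneg h.1.le]; exact h.2.le)

/-- Convergence of a nonnegative adapted process driven by random step sizes `μ n` that are
independent of the current data. -/
theorem ae_tendsto_and_summable_of_random_step {ℱ : Filtration ℕ m₀} {𝒢 : ℕ → MeasurableSpace Ω}
    (hℱ𝒢 : ∀ n, ℱ n ≤ 𝒢 n) (h𝒢 : ∀ n, 𝒢 n ≤ m₀) {μ : ℕ → Ω → ℝ}
    (hμm : ∀ n, Measurable (μ n)) (hμ : ∀ n, ∀ᵐ ω ∂P, μ n ω ∈ Set.Ioo (0 : ℝ) 1)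
    (hind : ∀ n, Indep (MeasurableSpace.comap (μ n) inferInstance) (𝒢 n) P)
    {Z q b g : ℕ → Ω → ℝ}
    (hZm : ∀ n, StronglyMeasurable[ℱ n] (Z n)) (hqm : ∀ n, StronglyMeasurable[ℱ n] (q n))
    (hbm : ∀ n, StronglyMeasurable[ℱ n] (b n)) (hgm : ∀ n, StronglyMeasurable[𝒢 n] (g n))
    (hZi : ∀ n, Integrable (Z n) P) (hqi : ∀ n, Integrable (q n) P)
    (hbi : ∀ n, Integrable (b n) P) (hgi : ∀ n, Integrable (g n) P)
    (hZ : ∀ n ω, 0 ≤ Z n ω) (hq : ∀ n ω, 0 ≤ q n ω) (hb : ∀ n ω, 0 ≤ b n ω)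
    (hstep : ∀ n, ∀ᵐ ω ∂P,
      Z (n + 1) ω + μ n ω * (1 - μ n ω) * b n ω ≤ Z n ω + μ n ω * g n ω)
    (hgq : ∀ n, P[g n | ℱ n] ≤ᵐ[P] q n)
    (hs : ∀ᵐ ω ∂P, Summable fun n => (∫ ω', μ n ω' ∂P) * q n ω) :
    ∀ᵐ ω ∂P, (∃ l, Tendsto (fun n => Z n ω) atTop (𝓝 l)) ∧
      Summable fun n => (∫ ω', μ n ω' * (1 - μ n ω') ∂P) * b n ω := by
  have hμ0 : ∀ n, 0 ≤ ∫ ω, μ n ω ∂P := fun n =>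
    integral_nonneg_of_ae ((hμ n).mono fun ω h => h.1.le)
  have hν0 : ∀ n, 0 ≤ ∫ ω, μ n ω * (1 - μ n ω) ∂P := fun n =>
    integral_nonneg_of_ae ((hμ n).mono fun ω h => mul_nonneg h.1.le (sub_nonneg.2 h.2.le))
  refine ae_tendsto_and_summable_of_condExp_le (ℱ := ℱ)
    (a := fun n ω => (∫ ω', μ n ω' ∂P) * q n ω)
    (b := fun n ω => (∫ ω', μ n ω' * (1 - μ n ω') ∂P) * b n ω)
    hZm (fun n => (hqm n).const_mul _) (fun n => (hbm n).const_mul _) hZi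
    (fun n => (hqi n).const_mul _) (fun n => (hbi n).const_mul _) hZ
    (fun n ω => mul_nonneg (hμ0 n) (hq n ω)) (fun n ω => mul_nonneg (hν0 n) (hb n ω))
    (fun n => ?_) hs
  have hμ1 : ∀ᵐ ω ∂P, ‖μ n ω‖ ≤ 1 := (hμ n).mono fun ω h => by
    rw [Real.norm_of_nonneg h.1.le]; exact h.2.le
  have hν1 : ∀ᵐ ω ∂P, ‖μ n ω * (1 - μ n ω)‖ ≤ 1 := (hμ n).mono fun ω h => by
    rw [Real.norm_of_nonneg (mul_nonneg h.1.le (sub_nonneg.2 h.2.le))]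
    nlinarith [h.1, h.2]
  have hμc : Measurable[MeasurableSpace.comap (μ n) inferInstance] (μ n) :=
    comap_measurable (μ n)
  have hνc : Measurable[MeasurableSpace.comap (μ n) inferInstance] fun ω => μ n ω * (1 - μ n ω) :=
    hμc.mul (measurable_const.sub hμc)
  have hle : MeasurableSpace.comap (μ n) inferInstance ≤ m₀ := (hμm n).comap_le
  have hνm : Measurable fun ω => μ n ω * (1 - μ n ω) := hνc.mono hle le_rfl
  have hνi : Integrable (fun ω => μ n ω * (1 - μ n ω)) P :=
    Integrable.of_bound hνm.aestronglyMeasurable 1 hν1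
  have hμi := integrable_of_ae_mem_Ioo (hμm n) (hμ n)
  have hμg : Integrable (fun ω => μ n ω * g n ω) P :=
    (hgi n).bdd_mul (hμm n).aestronglyMeasurable hμ1
  have hνb : Integrable (fun ω => μ n ω * (1 - μ n ω) * b n ω) P :=
    (hbi n).bdd_mul hνm.aestronglyMeasurable hν1
  -- Both μ and μ(1-μ) are functions of `μ n` alone, so each is averaged out separately.
  have e1 := condExp_mul_eq_integral_mul (hℱ𝒢 n) hle (h𝒢 n) (hind n)
    (Measurable.stronglyMeasurable hμc) hμi hμ1 (hgm n) (hgi n)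
  have e2 := condExp_mul_eq_integral_mul (hℱ𝒢 n) hle (h𝒢 n) (hind n)
    (Measurable.stronglyMeasurable hνc) hνi hν1 ((hbm n).mono (hℱ𝒢 n)) (hbi n)
  rw [condExp_of_stronglyMeasurable (ℱ.le n) (hbm n) (hbi n)] at e2
  have e3 : P[Z (n + 1) | ℱ n] ≤ᵐ[P]
      P[(Z n + fun ω => μ n ω * g n ω) - fun ω => μ n ω * (1 - μ n ω) * b n ω | ℱ n] := by
    refine condExp_mono (hZi _) (((hZi n).add hμg).sub hνb) ?_
    filter_upwards [hstep n] with ω h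
    simp only [Pi.sub_apply, Pi.add_apply]
    linarith
  have e4 := condExp_sub ((hZi n).add hμg) hνb (ℱ n)
  have e5 := condExp_add (hZi n) hμg (ℱ n)
  have e6 := condExp_of_stronglyMeasurable (μ := P) (ℱ.le n) (hZm n) (hZi n)
  filter_upwards [e1, e2, e3, e4, e5, hgq n] with ω e1 e2 e3 e4 e5 e7
  rw [e4, Pi.sub_apply, e5, Pi.add_apply, e1, e2, e6] at e3
  have := mul_le_mul_of_nonneg_left e7 (hμ0 n)
  linarith

end StochasticStep

/-! ### Measurability with respect to the past. -/

section SigmaUpTo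

variable {Ω H : Type*} [MeasurableSpace H]

theorem sigmaUpTo_mono (x : ℕ → Ω → H) : Monotone (sigmaUpTo x) := fun _ _ hmn =>
  iSup_mono fun _ => iSup_mono' fun hk => ⟨hk.trans hmn, le_rfl⟩

theorem sigmaUpTo_le [m₀ : MeasurableSpace Ω] {x : ℕ → Ω → H} (hx : ∀ n, Measurable (x n))
    (n : ℕ) : sigmaUpTo x n ≤ m₀ :=
  iSup₂_le fun k _ => (hx k).comap_le

theorem measurable_sigmaUpTo (x : ℕ → Ω → H) (n : ℕ) : Measurable[sigmaUpTo x n] (x n) :=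
  Measurable.of_comap_le (le_iSup₂_of_le n le_rfl le_rfl)

end SigmaUpTo

section Measurability

variable {Ω H : Type*} [NormedAddCommGroup H] [MeasurableSpace H] [BorelSpace H]
  {m : MeasurableSpace Ω} {u : Ω → H}

theorem stronglyMeasurable_norm (hu : Measurable u) : StronglyMeasurable fun ω => ‖u ω‖ :=
  hu.norm.stronglyMeasurable

theorem stronglyMeasurable_norm_sub_const [SecondCountableTopology H] (hu : Measurable u) (z : H) :
    StronglyMeasurable fun ω => ‖u ω - z‖ :=
  (hu.sub_const z).norm.stronglyMeasurable

theorem stronglyMeasurable_norm_residual [SecondCountableTopology H] {T : H → H}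
    (hT : Continuous T) (hu : Measurable u) : StronglyMeasurable fun ω => ‖T (u ω) - u ω‖ :=
  ((hT.measurable.comp hu).sub hu).norm.stronglyMeasurable

theorem stronglyMeasurable_norm_error (x e : ℕ → Ω → H) (n : ℕ) :
    StronglyMeasurable[MeasurableSpace.comap (e n) inferInstance ⊔ sigmaUpTo x n]
      fun ω => ‖e n ω‖ :=
  stronglyMeasurable_norm ((comap_measurable (e n)).mono le_sup_left le_rfl)

end Measurability

/-! ### Conditional size of the errors. -/

section CondError

variable {Ω H : Type*} [NormedAddCommGroup H] [MeasurableSpace H] {m₀ : MeasurableSpace Ω}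
  {P : Measure Ω} {x e : ℕ → Ω → H} {μ : ℕ → Ω → ℝ}

/-- The conditional root mean square of the `n`th error given the past iterates. -/
noncomputable def condError (P : Measure Ω) (x e : ℕ → Ω → H) (n : ℕ) (ω : Ω) : ℝ :=
  √((P[fun ω' => ‖e n ω'‖ ^ 2 | sigmaUpTo x n]) ω)

theorem stronglyMeasurable_condError (n : ℕ) :
    StronglyMeasurable[sigmaUpTo x n] (condError P x e n) :=
  Real.continuous_sqrt.comp_stronglyMeasurable stronglyMeasurable_condExp

theorem condError_sq (n : ℕ) :
    (fun ω => condError P x e n ω ^ 2) =ᵐ[P] P[fun ω' => ‖e n ω'‖ ^ 2 | sigmaUpTo x n] := by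
  have h1 : 0 ≤ᵐ[P] P[fun ω' => ‖e n ω'‖ ^ 2 | sigmaUpTo x n] :=
    condExp_nonneg (.of_forall fun ω => sq_nonneg _)
  filter_upwards [h1] with ω hω
  exact Real.sq_sqrt hω

/-- Along a path the conditional errors converge, hence are bounded by some C, and their squares are
at most C times themselves. -/
theorem ae_summable_condError_sq_of_tendsto
    (hs : ∀ᵐ ω ∂P, Summable fun n => (∫ ω', μ n ω' ∂P) * condError P x e n ω)
    (h0 : ∀ᵐ ω ∂P,
      Tendsto (fun n => (P[fun ω' => ‖e n ω'‖ ^ 2 | sigmaUpTo x n]) ω) atTop (𝓝 0))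
    (hμ : ∀ n, 0 ≤ ∫ ω, μ n ω ∂P) :
    ∀ᵐ ω ∂P, Summable fun n => (∫ ω', μ n ω' ∂P) * condError P x e n ω ^ 2 := by
  filter_upwards [hs, h0] with ω h1 h2
  have h3 : Tendsto (fun n => condError P x e n ω) atTop (𝓝 0) := by
    simpa [condError] using h2.sqrt
  obtain ⟨C, hC⟩ := h3.bddAbove_range
  have hnn : ∀ n, 0 ≤ condError P x e n ω := fun n => Real.sqrt_nonneg _
  refine (h1.mul_left C).of_nonneg_of_le (fun n => mul_nonneg (hμ n) (sq_nonneg _)) fun n => ?_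
  have h5 : condError P x e n ω ≤ C := hC ⟨n, rfl⟩
  have h6 := mul_le_mul_of_nonneg_right h5 (mul_nonneg (hμ n) (hnn n))
  linarith [h6, sq (condError P x e n ω)]

end CondError

/-- The stochastic Krasnosel'skiĭ–Mann iteration with errors `e n` and random relaxation
parameters `μ n`. -/
structure IsStochasticKM {H : Type*} [NormedAddCommGroup H] [InnerProductSpace ℝ H]
    [MeasurableSpace H] {Ω : Type*} [MeasurableSpace Ω] (P : Measure Ω) (T : H → H)
    (x e : ℕ → Ω → H) (μ : ℕ → Ω → ℝ) : Prop where
  lipschitz : LipschitzWith 1 T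
  fixedPoints_nonempty : (Function.fixedPoints T).Nonempty
  measurable_iterate : ∀ n, Measurable (x n)
  memLp_zero : MemLp (x 0) 2 P
  measurable_error : ∀ n, Measurable (e n)
  memLp_error : ∀ n, MemLp (e n) 2 P
  measurable_relax : ∀ n, Measurable (μ n)
  relax_mem : ∀ n, ∀ᵐ ω ∂P, μ n ω ∈ Set.Ioo (0 : ℝ) 1
  step : ∀ n, ∀ᵐ ω ∂P, x (n + 1) ω = x n ω + μ n ω • (T (x n ω) + e n ω - x n ω)
  relax_divergent :
    Tendsto (fun N : ℕ => ∑ n ∈ Finset.range N, ∫ ω, μ n ω * (1 - μ n ω) ∂P) atTop atTop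
  relax_indep : ∀ n, Indep (MeasurableSpace.comap (μ n) inferInstance)
    (MeasurableSpace.comap (e n) inferInstance ⊔ sigmaUpTo x n) P

/-! ### Asymptotics of the stochastic iteration. -/

namespace IsStochasticKM

variable {H : Type*} [NormedAddCommGroup H] [InnerProductSpace ℝ H] [MeasurableSpace H]
  {Ω : Type*} [m₀ : MeasurableSpace Ω] {P : Measure Ω} {T : H → H} {x e : ℕ → Ω → H}
  {μ : ℕ → Ω → ℝ}

/-- The natural filtration of the iterates. -/
def filtration (h : IsStochasticKM P T x e μ) : Filtration ℕ m₀ where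
  seq := sigmaUpTo x
  mono' := sigmaUpTo_mono x
  le' := sigmaUpTo_le h.measurable_iterate

theorem integral_relax_nonneg (h : IsStochasticKM P T x e μ) (n : ℕ) : 0 ≤ ∫ ω, μ n ω ∂P :=
  integral_nonneg_of_ae ((h.relax_mem n).mono fun _ hω => hω.1.le)

theorem integral_relax_variation_nonneg (h : IsStochasticKM P T x e μ) (n : ℕ) :
    0 ≤ ∫ ω, μ n ω * (1 - μ n ω) ∂P :=
  integral_nonneg_of_ae ((h.relax_mem n).mono fun _ hω =>
    mul_nonneg hω.1.le (sub_nonneg.2 hω.2.le))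

theorem ae_step_bounds (h : IsStochasticKM P T x e μ) {z : H} (hz : T z = z) :
    ∀ᵐ ω ∂P, ∀ n, 0 ≤ μ n ω ∧ ‖x (n + 1) ω - z‖ ≤ ‖x n ω - z‖ + μ n ω * ‖e n ω‖ := by
  rw [ae_all_iff]
  intro n
  filter_upwards [h.relax_mem n, h.step n] with ω h1 h2
  exact ⟨h1.1.le, norm_step_sub_le h.lipschitz hz h1.1.le h1.2.le h2⟩

theorem memLp_condError (h : IsStochasticKM P T x e μ) (n : ℕ) :
    MemLp (condError P x e n) 2 P := by
  have hm : AEStronglyMeasurable (condError P x e n) P :=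
    ((stronglyMeasurable_condError n).mono
      (sigmaUpTo_le h.measurable_iterate n)).aestronglyMeasurable
  rw [memLp_two_iff_integrable_sq hm]
  exact integrable_condExp.congr (condError_sq n).symm

variable [IsProbabilityMeasure P]

theorem memLp_relax (h : IsStochasticKM P T x e μ) (n : ℕ) : MemLp (μ n) 2 P :=
  MemLp.of_bound (h.measurable_relax n).aestronglyMeasurable 1
    ((h.relax_mem n).mono fun ω hω => by rw [Real.norm_of_nonneg hω.1.le]; exact hω.2.le)

theorem condExp_norm_error_le (h : IsStochasticKM P T x e μ) (n : ℕ) :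
    P[fun ω => ‖e n ω‖ | sigmaUpTo x n] ≤ᵐ[P] condError P x e n :=
  condExp_norm_le_sqrt (sigmaUpTo_le h.measurable_iterate n) (h.memLp_error n).norm

theorem integral_condError_sq (h : IsStochasticKM P T x e μ) (n : ℕ) :
    ∫ ω, condError P x e n ω ^ 2 ∂P = ∫ ω, ‖e n ω‖ ^ 2 ∂P := by
  rw [integral_congr_ae (condError_sq n), integral_condExp (sigmaUpTo_le h.measurable_iterate n)]

theorem summable_integral_relax_mul (h : IsStochasticKM P T x e μ)
    (hs : Summable fun n => √((∫ ω, μ n ω ^ 2 ∂P) * ∫ ω, ‖e n ω‖ ^ 2 ∂P)) :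
    Summable fun n => (∫ ω, μ n ω ∂P) * √(∫ ω, ‖e n ω‖ ^ 2 ∂P) := by
  refine hs.of_nonneg_of_le
    (fun n => mul_nonneg (h.integral_relax_nonneg n) (Real.sqrt_nonneg _)) fun n => ?_
  rw [Real.sqrt_mul (integral_nonneg fun ω => sq_nonneg _)]
  exact mul_le_mul_of_nonneg_right (integral_le_sqrt_integral_sq (h.memLp_relax n))
    (Real.sqrt_nonneg _)

/-- It suffices to sum expectations: by Cauchy–Schwarz the mean of `condError` is at most the root
mean square of the error itself. -/
theorem ae_summable_condError (h : IsStochasticKM P T x e μ)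
    (hs : Summable fun n => √((∫ ω, μ n ω ^ 2 ∂P) * ∫ ω, ‖e n ω‖ ^ 2 ∂P)) :
    ∀ᵐ ω ∂P, Summable fun n => (∫ ω', μ n ω' ∂P) * condError P x e n ω := by
  refine ae_summable_of_summable_integral
    (fun n => ((h.memLp_condError n).integrable one_le_two).const_mul _)
    (fun n => .of_forall fun ω => mul_nonneg (h.integral_relax_nonneg n) (Real.sqrt_nonneg _)) ?_
  refine (h.summable_integral_relax_mul hs).of_nonneg_of_le (fun n => integral_nonneg fun ω =>
    mul_nonneg (h.integral_relax_nonneg n) (Real.sqrt_nonneg _)) fun n => ?_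
  rw [integral_const_mul, ← h.integral_condError_sq]
  exact mul_le_mul_of_nonneg_left (integral_le_sqrt_integral_sq (h.memLp_condError n))
    (h.integral_relax_nonneg n)

theorem ae_summable_condError_sq (h : IsStochasticKM P T x e μ)
    (h0 : Tendsto (fun n => ∫ ω, ‖e n ω‖ ^ 2 ∂P) atTop (𝓝 0))
    (hs : Summable fun n => √((∫ ω, μ n ω ^ 2 ∂P) * ∫ ω, ‖e n ω‖ ^ 2 ∂P)) :
    ∀ᵐ ω ∂P, Summable fun n => (∫ ω', μ n ω' ∂P) * condError P x e n ω ^ 2 := by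
  refine ae_summable_of_summable_integral
    (fun n => (h.memLp_condError n).integrable_sq.const_mul _)
    (fun n => .of_forall fun ω => mul_nonneg (h.integral_relax_nonneg n) (sq_nonneg _)) ?_
  -- The vanishing of E‖e_n‖² is used here only as boundedness, to absorb one factor of the square.
  obtain ⟨C, hC⟩ := h0.sqrt.bddAbove_range
  refine ((h.summable_integral_relax_mul hs).mul_left C).of_nonneg_of_le
    (fun n => integral_nonneg fun ω => mul_nonneg (h.integral_relax_nonneg n) (sq_nonneg _))
    fun n => ?_
  rw [integral_const_mul, h.integral_condError_sq]
  have h1 : √(∫ ω, ‖e n ω‖ ^ 2 ∂P) ≤ C := hC ⟨n, rfl⟩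
  have h2 : √(∫ ω, ‖e n ω‖ ^ 2 ∂P) ^ 2 = ∫ ω, ‖e n ω‖ ^ 2 ∂P :=
    Real.sq_sqrt (integral_nonneg fun ω => sq_nonneg _)
  have h3 := mul_le_mul_of_nonneg_right h1
    (mul_nonneg (h.integral_relax_nonneg n) (Real.sqrt_nonneg (∫ ω, ‖e n ω‖ ^ 2 ∂P)))
  refine le_trans (le_of_eq ?_) h3
  rw [mul_left_comm, ← sq, h2]

variable [BorelSpace H]

/-- The iterates are dominated by a square integrable function. -/
theorem exists_memLp_bound (h : IsStochasticKM P T x e μ) {z : H} (hz : T z = z)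
    (hs : Summable fun n => √((∫ ω, μ n ω ^ 2 ∂P) * ∫ ω, ‖e n ω‖ ^ 2 ∂P)) :
    ∃ G : Ω → ℝ, MemLp G 2 P ∧ ∀ n, ∀ᵐ ω ∂P, ‖x n ω - z‖ ≤ G ω := by
  have hmem : ∀ n, MemLp (fun ω => μ n ω * ‖e n ω‖) 2 P := by
    intro n
    refine (h.memLp_error n).of_le
      ((h.measurable_relax n).mul (h.measurable_error n).norm).aestronglyMeasurable ?_
    filter_upwards [h.relax_mem n] with ω hω
    rw [norm_mul, norm_norm, Real.norm_of_nonneg hω.1.le]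
    exact mul_le_of_le_one_left (norm_nonneg _) hω.2.le
  have hnn : ∀ n, 0 ≤ᵐ[P] fun ω => μ n ω * ‖e n ω‖ := fun n =>
    (h.relax_mem n).mono fun ω hω => mul_nonneg hω.1.le (norm_nonneg _)
  -- Independence of μ_n and e_n makes the assumed series exactly the series of L² norms of
  -- μ_n‖e_n‖.
  have hint : ∀ n, ∫ ω, (μ n ω * ‖e n ω‖) ^ 2 ∂P =
      (∫ ω, μ n ω ^ 2 ∂P) * ∫ ω, ‖e n ω‖ ^ 2 ∂P := by
    intro n
    have h1 : IndepFun (μ n) (e n) P :=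
      (IndepFun_iff_Indep _ _ _).2 (indep_of_indep_of_le_right (h.relax_indep n) le_sup_left)
    have h2 : IndepFun (fun ω => μ n ω ^ 2) (fun ω => ‖e n ω‖ ^ 2) P :=
      h1.comp (φ := fun t : ℝ => t ^ 2) (ψ := fun v : H => ‖v‖ ^ 2)
        (by fun_prop) (by fun_prop)
    simp_rw [mul_pow]
    exact h2.integral_fun_mul_eq_mul_integral
      ((h.measurable_relax n).pow_const 2).aestronglyMeasurable
      ((h.measurable_error n).norm.pow_const 2).aestronglyMeasurable
  obtain ⟨h1, h2⟩ := ae_summable_and_memLp_tsum hmem hnn (by simpa only [hint] using hs)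
  refine ⟨fun ω => ‖x 0 ω - z‖ + ∑' n, μ n ω * ‖e n ω‖,
    ((h.memLp_zero.sub (memLp_const z)).norm).add h2, ae_all_iff.1 ?_⟩
  filter_upwards [h1, h.ae_step_bounds hz] with ω h3 h4 n
  have h5 : ‖x n ω - z‖ ≤ ‖x 0 ω - z‖ + ∑ k ∈ Finset.range n, μ k ω * ‖e k ω‖ := by
    induction n with
    | zero => simp
    | succ n ih =>
      rw [Finset.sum_range_succ]
      linarith [(h4 n).2]
  refine h5.trans ?_
  gcongr
  exact h3.sum_le_tsum _ fun k _ => mul_nonneg (h4 k).1 (norm_nonneg _)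

variable [TopologicalSpace.SeparableSpace H]

theorem memLp_residual (h : IsStochasticKM P T x e μ) {n : ℕ} (hx : MemLp (x n) 2 P) :
    MemLp (fun ω => T (x n ω) - x n ω) 2 P := by
  have : SecondCountableTopology H := UniformSpace.secondCountable_of_separable H
  obtain ⟨z, hz⟩ := h.fixedPoints_nonempty
  have hm : Measurable fun ω => T (x n ω) - x n ω :=
    (h.lipschitz.continuous.measurable.comp (h.measurable_iterate n)).sub (h.measurable_iterate n)
  have hxz : MemLp (fun ω => x n ω - z) 2 P := hx.sub (memLp_const z)
  refine hxz.of_le_mul (c := 2) hm.aestronglyMeasurable (.of_forall fun ω => ?_)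
  have h1 : ‖T (x n ω) - z‖ ≤ ‖x n ω - z‖ := by
    simpa [dist_eq_norm, show T z = z from hz] using h.lipschitz.dist_le_mul (x n ω) z
  have h2 : T (x n ω) - x n ω = (T (x n ω) - z) - (x n ω - z) := by abel
  rw [h2]
  refine (norm_sub_le _ _).trans ?_
  linarith

/-- Provides the integrability behind all conditional expectations, with no summability assumption.
-/
theorem memLp_iterate (h : IsStochasticKM P T x e μ) (n : ℕ) : MemLp (x n) 2 P := by
  have : SecondCountableTopology H := UniformSpace.secondCountable_of_separable H
  induction n with
  | zero => exact h.memLp_zero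
  | succ n ih =>
    have h1 : MemLp (fun ω => (T (x n ω) - x n ω) + e n ω) 2 P :=
      (h.memLp_residual ih).add (h.memLp_error n)
    have h2 : MemLp (fun ω => μ n ω • ((T (x n ω) - x n ω) + e n ω)) 2 P := by
      refine h1.of_le ((h.measurable_relax n).aestronglyMeasurable.smul h1.aestronglyMeasurable) ?_
      filter_upwards [h.relax_mem n] with ω hω
      rw [norm_smul, Real.norm_of_nonneg hω.1.le]
      exact mul_le_of_le_one_left (norm_nonneg _) hω.2.le
    refine (memLp_congr_ae ?_).1 (ih.add h2)
    filter_upwards [h.step n] with ω hω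
    rw [hω, Pi.add_apply, sub_add_eq_add_sub]

theorem ae_norm_sub_tendsto (h : IsStochasticKM P T x e μ)
    (hs : ∀ᵐ ω ∂P, Summable fun n => (∫ ω', μ n ω' ∂P) * condError P x e n ω)
    {z : H} (hz : T z = z) : ∀ᵐ ω ∂P, ∃ l, Tendsto (fun n => ‖x n ω - z‖) atTop (𝓝 l) := by
  have : SecondCountableTopology H := UniformSpace.secondCountable_of_separable H
  refine (ae_tendsto_and_summable_of_random_step (ℱ := h.filtration)
    (𝒢 := fun n => MeasurableSpace.comap (e n) inferInstance ⊔ sigmaUpTo x n)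
    (Z := fun n ω => ‖x n ω - z‖) (q := condError P x e) (b := fun _ _ => 0)
    (g := fun n ω => ‖e n ω‖)
    (fun n => le_sup_right)
    (fun n => sup_le (h.measurable_error n).comap_le (sigmaUpTo_le h.measurable_iterate n))
    h.measurable_relax h.relax_mem h.relax_indep
    (fun n => stronglyMeasurable_norm_sub_const (measurable_sigmaUpTo x n) z)
    stronglyMeasurable_condError
    (fun n => stronglyMeasurable_const)
    (stronglyMeasurable_norm_error x e)
    (fun n => (((h.memLp_iterate n).sub (memLp_const z)).integrable one_le_two).norm)
    (fun n => (h.memLp_condError n).integrable one_le_two)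
    (fun n => integrable_const 0)
    (fun n => ((h.memLp_error n).integrable one_le_two).norm)
    (fun n ω => norm_nonneg _) (fun n ω => Real.sqrt_nonneg _) (fun n ω => le_rfl)
    (fun n => ?_) h.condExp_norm_error_le hs).mono fun ω hω => hω.1
  filter_upwards [h.ae_step_bounds hz] with ω hω
  simpa using (hω n).2

/-- Convergence of the whole residual sequence is needed, since the weighted summability of its
squares alone would only give a zero lower limit. -/
theorem ae_norm_residual_tendsto (h : IsStochasticKM P T x e μ)
    (hs : ∀ᵐ ω ∂P, Summable fun n => (∫ ω', μ n ω' ∂P) * condError P x e n ω) :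
    ∀ᵐ ω ∂P, ∃ l, Tendsto (fun n => ‖T (x n ω) - x n ω‖) atTop (𝓝 l) := by
  have : SecondCountableTopology H := UniformSpace.secondCountable_of_separable H
  refine (ae_tendsto_and_summable_of_random_step (ℱ := h.filtration)
    (𝒢 := fun n => MeasurableSpace.comap (e n) inferInstance ⊔ sigmaUpTo x n)
    (Z := fun n ω => ‖T (x n ω) - x n ω‖) (q := fun n ω => 2 * condError P x e n ω)
    (b := fun _ _ => 0) (g := fun n ω => 2 * ‖e n ω‖)
    (fun n => le_sup_right)
    (fun n => sup_le (h.measurable_error n).comap_le (sigmaUpTo_le h.measurable_iterate n))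
    h.measurable_relax h.relax_mem h.relax_indep
    (fun n => stronglyMeasurable_norm_residual h.lipschitz.continuous (measurable_sigmaUpTo x n))
    (fun n => (stronglyMeasurable_condError n).const_mul 2)
    (fun n => stronglyMeasurable_const)
    (fun n => (stronglyMeasurable_norm_error x e n).const_mul 2)
    (fun n => ((h.memLp_residual (h.memLp_iterate n)).integrable one_le_two).norm)
    (fun n => ((h.memLp_condError n).integrable one_le_two).const_mul 2)
    (fun n => integrable_const 0)
    (fun n => ((h.memLp_error n).integrable one_le_two).norm.const_mul 2)
    (fun n ω => norm_nonneg _) (fun n ω => mul_nonneg zero_le_two (Real.sqrt_nonneg _))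
    (fun n ω => le_rfl)
    (fun n => ?_) (fun n => ?_) (hs.mono fun ω hω => ?_)).mono fun ω hω => hω.1
  · filter_upwards [h.relax_mem n, h.step n] with ω h1 h2
    simpa using norm_step_residual_le h.lipschitz h1.1.le h1.2.le h2
  · filter_upwards [condExp_smul (μ := P) (2 : ℝ) (fun ω => ‖e n ω‖) (sigmaUpTo x n),
      h.condExp_norm_error_le n] with ω h1 h2
    refine h1.le.trans ?_
    simp only [Pi.smul_apply, smul_eq_mul]
    linarith
  · exact (hω.mul_left 2).congr fun n => by ring

theorem ae_summable_norm_residual_sq (h : IsStochasticKM P T x e μ)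
    (hs : ∀ᵐ ω ∂P, Summable fun n => (∫ ω', μ n ω' ∂P) * condError P x e n ω)
    (hs2 : ∀ᵐ ω ∂P, Summable fun n => (∫ ω', μ n ω' ∂P) * condError P x e n ω ^ 2) :
    ∀ᵐ ω ∂P, Summable fun n =>
      (∫ ω', μ n ω' * (1 - μ n ω') ∂P) * (‖T (x n ω) - x n ω‖ ^ 2 / 2) := by
  have : SecondCountableTopology H := UniformSpace.secondCountable_of_separable H
  obtain ⟨z, hz⟩ := h.fixedPoints_nonempty
  have hxm := fun n => stronglyMeasurable_norm_sub_const (measurable_sigmaUpTo x n) z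
  have hxm' : ∀ n, StronglyMeasurable[MeasurableSpace.comap (e n) inferInstance ⊔ sigmaUpTo x n]
      fun ω => ‖x n ω - z‖ := fun n => (hxm n).mono le_sup_right
  have hx2 : ∀ n, MemLp (fun ω => x n ω - z) 2 P := fun n =>
    (h.memLp_iterate n).sub (memLp_const z)
  have hxe : ∀ n, Integrable (fun ω => ‖x n ω - z‖ * ‖e n ω‖) P := fun n =>
    (hx2 n).norm.integrable_mul (h.memLp_error n).norm
  have he2 : ∀ n, Integrable (fun ω => ‖e n ω‖ ^ 2) P := fun n =>
    (h.memLp_error n).norm.integrable_sq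
  refine (ae_tendsto_and_summable_of_random_step (ℱ := h.filtration)
    (𝒢 := fun n => MeasurableSpace.comap (e n) inferInstance ⊔ sigmaUpTo x n)
    (Z := fun n ω => ‖x n ω - z‖ ^ 2)
    (q := fun n ω => 2 * (‖x n ω - z‖ * condError P x e n ω + condError P x e n ω ^ 2))
    (b := fun n ω => ‖T (x n ω) - x n ω‖ ^ 2 / 2)
    (g := fun n ω => 2 * (‖x n ω - z‖ * ‖e n ω‖ + ‖e n ω‖ ^ 2))
    (fun n => le_sup_right)
    (fun n => sup_le (h.measurable_error n).comap_le (sigmaUpTo_le h.measurable_iterate n))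
    h.measurable_relax h.relax_mem h.relax_indep
    (fun n => (hxm n).pow 2)
    (fun n => (((hxm n).mul (stronglyMeasurable_condError n)).add
      ((stronglyMeasurable_condError n).pow 2)).const_mul 2)
    (fun n => ((stronglyMeasurable_norm_residual h.lipschitz.continuous
      (measurable_sigmaUpTo x n)).pow 2).div stronglyMeasurable_const)
    (fun n => (((hxm' n).mul (stronglyMeasurable_norm_error x e n)).add
      ((stronglyMeasurable_norm_error x e n).pow 2)).const_mul 2)
    (fun n => (hx2 n).norm.integrable_sq)
    (fun n => (((hx2 n).norm.integrable_mul (h.memLp_condError n)).add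
      (h.memLp_condError n).integrable_sq).const_mul 2)
    (fun n => (h.memLp_residual (h.memLp_iterate n)).norm.integrable_sq.div_const 2)
    (fun n => ((hxe n).add (he2 n)).const_mul 2)
    (fun n ω => sq_nonneg _)
    (fun n ω => mul_nonneg zero_le_two (add_nonneg (mul_nonneg (norm_nonneg _)
      (Real.sqrt_nonneg _)) (sq_nonneg _)))
    (fun n ω => by positivity)
    (fun n => ?_) (fun n => ?_) ?_).mono fun ω hω => hω.2
  · filter_upwards [h.relax_mem n, h.step n] with ω h1 h2
    refine (norm_step_sub_sq_le h.lipschitz hz h1.1.le h1.2.le h2).trans (le_of_eq ?_)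
    ring
  · have h1 := condExp_smul (μ := P) (2 : ℝ)
      ((fun ω => ‖x n ω - z‖ * ‖e n ω‖) + fun ω => ‖e n ω‖ ^ 2) (sigmaUpTo x n)
    have h2 := condExp_add (hxe n) (he2 n) (sigmaUpTo x n)
    have h3 := condExp_mul_of_stronglyMeasurable_left (hxm n) (hxe n)
      ((h.memLp_error n).integrable one_le_two).norm
    filter_upwards [h1, h2, h3, h.condExp_norm_error_le n, condError_sq (P := P) (x := x) (e := e) n]
      with ω h1 h2 h3 h4 h5
    refine h1.le.trans ?_
    rw [Pi.smul_apply, smul_eq_mul, h2, Pi.add_apply, h5]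
    have h6 : (P[fun ω => ‖x n ω - z‖ * ‖e n ω‖ | sigmaUpTo x n]) ω ≤
        ‖x n ω - z‖ * condError P x e n ω :=
      h3.le.trans (mul_le_mul_of_nonneg_left h4 (norm_nonneg _))
    linarith
  · filter_upwards [hs, hs2, h.ae_norm_sub_tendsto hs hz] with ω h1 h2 h3
    obtain ⟨l, hl⟩ := h3
    -- The bound on ‖x_n - z‖ depends on the path, which is enough because the perturbations need
    -- only be summable almost surely.
    obtain ⟨C, hC⟩ := hl.bddAbove_range
    have h4 := ((h1.mul_left C).add h2).mul_left 2
    refine h4.of_nonneg_of_le (fun n => mul_nonneg (h.integral_relax_nonneg n) (mul_nonneg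
      zero_le_two (add_nonneg (mul_nonneg (norm_nonneg _) (Real.sqrt_nonneg _)) (sq_nonneg _))))
      fun n => ?_
    have h5 : ‖x n ω - z‖ ≤ C := hC ⟨n, rfl⟩
    have h6 : 0 ≤ (∫ ω', μ n ω' ∂P) * condError P x e n ω :=
      mul_nonneg (h.integral_relax_nonneg n) (Real.sqrt_nonneg _)
    nlinarith [mul_le_mul_of_nonneg_right h5 h6]

theorem ae_residual_tendsto_zero (h : IsStochasticKM P T x e μ)
    (hs : ∀ᵐ ω ∂P, Summable fun n => (∫ ω', μ n ω' ∂P) * condError P x e n ω)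
    (hs2 : ∀ᵐ ω ∂P, Summable fun n => (∫ ω', μ n ω' ∂P) * condError P x e n ω ^ 2) :
    ∀ᵐ ω ∂P, Tendsto (fun n => T (x n ω) - x n ω) atTop (𝓝 0) := by
  filter_upwards [h.ae_norm_residual_tendsto hs, h.ae_summable_norm_residual_sq hs hs2]
    with ω ⟨l, hl⟩ h2
  have h3 := tendsto_zero_of_summable_mul h.integral_relax_variation_nonneg h.relax_divergent h2
    (by positivity) ((hl.pow 2).div_const 2)
  have h4 : l = 0 := by simpa using h3
  rw [h4] at hl
  exact tendsto_zero_iff_norm_tendsto_zero.2 hl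

/-- The null set off which ‖x_n - d‖ converges depends on d; separability allows countably many d.
-/
theorem ae_exists_weakTendsto [CompleteSpace H] (h : IsStochasticKM P T x e μ)
    (hs : ∀ᵐ ω ∂P, Summable fun n => (∫ ω', μ n ω' ∂P) * condError P x e n ω)
    (hs2 : ∀ᵐ ω ∂P, Summable fun n => (∫ ω', μ n ω' ∂P) * condError P x e n ω ^ 2) :
    ∀ᵐ ω ∂P, ∃ z ∈ Function.fixedPoints T, WeakTendsto (fun n => x n ω) z := by
  obtain ⟨D, hDF, hDc, hD⟩ := (TopologicalSpace.IsSeparable.of_separableSpace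
    (Function.fixedPoints T)).exists_countable_dense_subset
  have hDne : D.Nonempty := closure_nonempty_iff.1 (h.fixedPoints_nonempty.mono hD)
  have h1 : ∀ᵐ ω ∂P, ∀ d ∈ D, ∃ l, Tendsto (fun n => ‖x n ω - d‖) atTop (𝓝 l) :=
    (ae_ball_iff hDc).2 fun d hd => h.ae_norm_sub_tendsto hs (hDF hd)
  filter_upwards [h1, h.ae_residual_tendsto_zero hs hs2] with ω h1 h2
  exact exists_weakTendsto_fixedPoint h.lipschitz hDne hD h1 h2

end IsStochasticKM

/-! ### Strong convergence and conclusion. -/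

theorem Demiregular.tendsto_of_residual {H : Type*} [NormedAddCommGroup H] [InnerProductSpace ℝ H]
    {T : H → H} {u : ℕ → H} {z : H} (hz : T z = z) (hd : Demiregular (fun y => T y - y) z)
    (hu : WeakTendsto u z) (hTu : Tendsto (fun n => T (u n) - u n) atTop (𝓝 0)) :
    Tendsto u atTop (𝓝 z) :=
  hd u hu (by simpa [hz] using hTu)


theorem theorem4p1
    {H : Type*} [NormedAddCommGroup H] [InnerProductSpace ℝ H] [CompleteSpace H]
    [TopologicalSpace.SeparableSpace H] [MeasurableSpace H] [BorelSpace H]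
    {Ω : Type*} [MeasurableSpace Ω] (P : Measure Ω) [IsProbabilityMeasure P]
    (T : H → H) (hT : LipschitzWith 1 T) (hFix : (Function.fixedPoints T).Nonempty)
    (x e : ℕ → Ω → H) (μ : ℕ → Ω → ℝ)
    (hx_meas : ∀ n, Measurable (x n)) (hx0 : MemLp (x 0) 2 P)
    (he_meas : ∀ n, Measurable (e n)) (he : ∀ n, MemLp (e n) 2 P)
    (hμ_meas : ∀ n, Measurable (μ n)) (hμ : ∀ n, ∀ᵐ ω ∂P, μ n ω ∈ Set.Ioo (0 : ℝ) 1)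
    (hrec : ∀ n, ∀ᵐ ω ∂P, x (n + 1) ω = x n ω + μ n ω • (T (x n ω) + e n ω - x n ω))
    (hdiv : Tendsto (fun N : ℕ => ∑ n ∈ Finset.range N, ∫ ω, μ n ω * (1 - μ n ω) ∂P) atTop atTop)
    (hindep : ∀ n, Indep (MeasurableSpace.comap (μ n) inferInstance)
      (MeasurableSpace.comap (e n) inferInstance ⊔ sigmaUpTo x n) P) :
    ∃ xlim : Ω → H, Measurable xlim ∧ (∀ ω, xlim ω ∈ Function.fixedPoints T) ∧
      -- conditional error conditions
      ((∀ᵐ ω ∂P, Tendsto (fun n => (P[fun ω' => ‖e n ω'‖ ^ 2 | sigmaUpTo x n]) ω) atTop (𝓝 0)) →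
        (∀ᵐ ω ∂P, Summable (fun n =>
          (∫ ω', μ n ω' ∂P) * √((P[fun ω' => ‖e n ω'‖ ^ 2 | sigmaUpTo x n]) ω))) →
        (∀ᵐ ω ∂P, Tendsto (fun n => T (x n ω) - x n ω) atTop (𝓝 0)) ∧
        (∀ᵐ ω ∂P, WeakTendsto (fun n => x n ω) (xlim ω)) ∧
        ((∀ z ∈ Function.fixedPoints T, Demiregular (fun y => T y - y) z) →
          ∀ᵐ ω ∂P, Tendsto (fun n => x n ω) atTop (𝓝 (xlim ω)))) ∧
      -- error conditions in expectation
      (Tendsto (fun n => ∫ ω, ‖e n ω‖ ^ 2 ∂P) atTop (𝓝 0) →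
        Summable (fun n => √((∫ ω, μ n ω ^ 2 ∂P) * ∫ ω, ‖e n ω‖ ^ 2 ∂P)) →
        (TendstoInL1 P (fun n ω => T (x n ω) - x n ω) (fun _ => 0) ∧
          ∀ᵐ ω ∂P, Tendsto (fun n => T (x n ω) - x n ω) atTop (𝓝 0)) ∧
        (MemLp xlim 2 P ∧ WeakTendstoInL2 P x xlim ∧
          ∀ᵐ ω ∂P, WeakTendsto (fun n => x n ω) (xlim ω)) ∧
        ((∀ z ∈ Function.fixedPoints T, Demiregular (fun y => T y - y) z) →
          TendstoInL1 P x xlim ∧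
          ∀ᵐ ω ∂P, Tendsto (fun n => x n ω) atTop (𝓝 (xlim ω)))) := by
  have h : IsStochasticKM P T x e μ :=
    ⟨hT, hFix, hx_meas, hx0, he_meas, he, hμ_meas, hμ, hrec, hdiv, hindep⟩
  -- One limit must serve both parts, so it is fixed before either set of error conditions is
  -- assumed; where almost sure weak convergence fails, any constant fixed point will do.
  have hsel : ∃ xlim : Ω → H, Measurable xlim ∧ (∀ ω, xlim ω ∈ Function.fixedPoints T) ∧
      ((∀ᵐ ω ∂P, ∃ z ∈ Function.fixedPoints T, WeakTendsto (fun n => x n ω) z) →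
        ∀ᵐ ω ∂P, WeakTendsto (fun n => x n ω) (xlim ω)) := by
    by_cases hw : ∀ᵐ ω ∂P, ∃ z ∈ Function.fixedPoints T, WeakTendsto (fun n => x n ω) z
    · obtain ⟨y, hy, hyF, hyw⟩ := exists_measurable_weakTendsto hFix hx_meas hw
      exact ⟨y, hy, hyF, fun _ => hyw⟩
    · obtain ⟨z, hz⟩ := hFix
      exact ⟨fun _ => z, measurable_const, fun _ => hz, fun hw' => absurd hw' hw⟩
  obtain ⟨xlim, hxm, hxF, hxw⟩ := hsel
  have hstrong : (∀ᵐ ω ∂P, Tendsto (fun n => T (x n ω) - x n ω) atTop (𝓝 0)) →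
      (∀ᵐ ω ∂P, WeakTendsto (fun n => x n ω) (xlim ω)) →
      (∀ z ∈ Function.fixedPoints T, Demiregular (fun y => T y - y) z) →
      ∀ᵐ ω ∂P, Tendsto (fun n => x n ω) atTop (𝓝 (xlim ω)) := by
    intro hr hw hd
    filter_upwards [hr, hw] with ω h1 h2
    exact (hd _ (hxF ω)).tendsto_of_residual (hxF ω) h2 h1
  refine ⟨xlim, hxm, hxF, fun h0 hs => ?_, fun h0 hs => ?_⟩
  · have hs2 := ae_summable_condError_sq_of_tendsto hs h0 h.integral_relax_nonneg
    have hr := h.ae_residual_tendsto_zero hs hs2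
    have hw := hxw (h.ae_exists_weakTendsto hs hs2)
    exact ⟨hr, hw, hstrong hr hw⟩
  · have hs1 := h.ae_summable_condError hs
    have hs2 := h.ae_summable_condError_sq h0 hs
    have hr := h.ae_residual_tendsto_zero hs1 hs2
    have hw := hxw (h.ae_exists_weakTendsto hs1 hs2)
    have : SecondCountableTopology H := UniformSpace.secondCountable_of_separable H
    obtain ⟨z, hz⟩ := hFix
    obtain ⟨G, hG, hxG⟩ := h.exists_memLp_bound hz hs
    have hG' : MemLp (fun ω => G ω + ‖z‖) 2 P := hG.add (memLp_const _)
    have hxG' : ∀ n, ∀ᵐ ω ∂P, ‖x n ω‖ ≤ G ω + ‖z‖ := fun n => by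
      filter_upwards [hxG n] with ω hω
      have := norm_add_le (x n ω - z) z
      rw [sub_add_cancel] at this
      linarith
    have hxa : ∀ n, AEStronglyMeasurable (x n) P := fun n => (hx_meas n).aestronglyMeasurable
    have hweak := weakTendstoInL2_of_dominated hxa hxm.aestronglyMeasurable hG' hxG' hw
    refine ⟨⟨?_, hr⟩, ⟨hweak.2.1, hweak, hw⟩, fun hd => ⟨?_, hstrong hr hw hd⟩⟩
    -- Since T is nonexpansive and fixes z, the residual is at most 2‖x_n - z‖, hence the majorant
    -- 2G.
    · refine tendstoInL1_of_dominated
        (fun n => (h.memLp_residual (h.memLp_iterate n)).aestronglyMeasurable)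
        ((hG.integrable one_le_two).const_mul 2) (fun n => ?_) hr
      filter_upwards [hxG n] with ω hω
      have h1 : ‖T (x n ω) - z‖ ≤ ‖x n ω - z‖ := by
        simpa [dist_eq_norm, show T z = z from hz] using hT.dist_le_mul (x n ω) z
      have h2 := norm_sub_le (T (x n ω) - z) (x n ω - z)
      rw [sub_sub_sub_cancel_right] at h2
      linarith
    · exact tendstoInL1_of_dominated hxa (hG'.integrable one_le_two) hxG' (hstrong hr hw hd)
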